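/- For $n\ge k\ge 1$, the book $B_{k,n}$ is the graph on $n$ vertices consisting of a clique $K_k$ (the spine) together with $n-k$ further pairwise non-adjacent vertices, each joined to every vertex of the spine. For graphs $G,H$, the Ramsey number $r(G,H)$ is the smallest $N$ such that every graph $\Gamma$ on $N$ vertices contains $G$ as a (not necessarily induced) subgraph or its complement $\overline{\Gamma}$ contains $H$ as a subgraph. Let $K_p(a_1,\dots,a_p)$ denote the complete $p$-partite graph with parts of sizes $a_1,\dots,a_p$. **Theorem 1.3.** For all integers $k,p,t\ge 2$ there exists a real number $\delta\ge 2^{-t^{1000k^2p^2}}$ such that the following holds for all integers $n\ge 1$. Let $a_1,\dots,a_p$ be positive integers with $1\le a_1\le\dots\le a_{p-1}\le t$ and $a_p\le\delta n$, and suppose that $a_p\ge a_1$ and that $a_p\ge 2$ if $a_2\ge 2$ (both are automatic if $a_1\le\dots\le a_p$). Let $G=K_p(a_1,\dots,a_p)$. Then $$r(G,B_{k,n})=(p-1)(n-1)+a_1\quad\text{if and only if}\quad a_1=a_2=1.$$ More precisely: (i) if $a_1=a_2=1$, then $r(G,B_{k,n})=(p-1)(n-1)+a_1$; (ii) if $a_2\ge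 2$, then $r(G,B_{k,n})>(p-1)(n-1)+a_1$. (The condition $a_p\le\delta n$ is understood to make $n\ge k$, so that $B_{k,n}$ is defined; this is so for $\delta=2^{-t^{1000k^2p^2}}$.) -/

import Mathlib

/-- The Ramsey number `r(G, H)`: the smallest `N` such that every graph `Γ` on `N` vertices
contains `G` as a (not necessarily induced) subgraph, or its complement contains `H` as a
subgraph. -/
noncomputable def ramseyNumber {V W : Type*} (G : SimpleGraph V) (H : SimpleGraph W) : ℕ :=
  sInf {N : ℕ | ∀ Γ : SimpleGraph (Fin N), G.IsContained Γ ∨ H.IsContained Γᶜ}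

/-- The `k`-book `B_{k,n}` on `n` vertices: the vertices `0, …, k - 1` form the spine, which is a
clique, and each of the remaining `n - k` vertices is joined to exactly the spine vertices. -/
def bookGraph (k n : ℕ) : SimpleGraph (Fin n) where
  Adj u v := u ≠ v ∧ (u.val < k ∨ v.val < k)
  symm := ⟨fun _ _ h => ⟨h.1.symm, h.2.symm⟩⟩
  loopless := ⟨fun _ h => h.1 rfl⟩

/-- The complete `p`-partite graph `K_p(a_1, …, a_p)`. The part sizes are the values of `a` at
`1, …, p`; part number `i : Fin p` has size `a (i + 1)`. -/
def completePartite (p : ℕ) (a : ℕ → ℕ) : SimpleGraph (Σ i : Fin p, Fin (a (i.val + 1))) :=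
  SimpleGraph.completeMultipartiteGraph fun i : Fin p => Fin (a (i.val + 1))

/-!
The case `a 2 ≥ 2` is a construction: the complete multipartite graph with parts of sizes `a 1 - 1`,
`n - 1` (`p - 2` times) and `n`, with a maximum matching added to the last part
(`extremalGraph`). As `k ≥ 2`, the matching destroys every book `B_{k,n}` in the complement of the
last part, while a copy of `K_p(a_1, …, a_p)` would put a complete bipartite graph on at least three
vertices into the matching.

For `a 1 = a 2 = 1` the lower bound comes from disjoint cliques. For the upper bound let `r = p - 1`
and let `Γ` have `r (n - 1) + 1` vertices and no book in its complement, so that every independent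
`k`-set has fewer than `n` common non-neighbours. Instead of a regularity lemma, the proof uses that
dense families of cliques contain complete multipartite blow-ups (`density_blowup`).

* If `Γ` has many `(r + 1)`-cliques, a blow-up with one part of linear size contains the multipartite
  graph (`exists_blowup_linear_part`). So let there be very few of them.
* `Γ` has many `r`-cliques (`inv_two_pow_le_density_clique`): for `j < r`, a blow-up of `j`-cliques
  with independent parts of size `k` leaves at least `n` vertices that have a neighbour in each
  part, so `j`-cliques extend in many ways.
* A blow-up of `r`-cliques with large independent parts then yields `r` almost disjoint sparse sets
  of size about `n` (`exists_sparse_sets`). A random `k`-tuple in one of them is independent, and its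
  non-neighbourhood is used up by the set itself, so the sets are nearly completely joined
  to each other (`density_outside_le`, `exists_nearly_complete`).
* Exactness comes from a charging argument (`false_of_blocks`). Cut the nearly complete sets `T i` into
  blocks of size `k`. An edge `u w` with `w ∈ T i` extends greedily to the multipartite graph if `u` has
  many neighbours in the other sets (`hasParts_of_edge`). If none does, the blocks are independent and
  every vertex misses, over all `i`, at least as many blocks as one `T i` has: either it has no
  neighbour in some `T i`, or it misses half of the blocks of two of these sets. Hence some block is
  missed by more than `n - 1` vertices, which gives a book.
-/

/-! ### Uniform densities and Jensen's inequality -/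

open Classical in
/-- The proportion of elements of the finite type `α` that satisfy `P`
(it is `0` if `α` is empty). -/
noncomputable def density {α : Type*} [Fintype α] (P : α → Prop) : ℝ :=
  (Finset.univ.filter P).card / Fintype.card α

section Density

variable {α β : Type*} [Fintype α] [Fintype β]

theorem density_nonneg (P : α → Prop) : 0 ≤ density P := by
  unfold density; positivity

theorem card_filter_eq_density [Nonempty α] (P : α → Prop) [DecidablePred P] :
    ((Finset.univ.filter P).card : ℝ) = density P * Fintype.card α := by
  unfold density
  rw [div_mul_cancel₀ _ (by positivity)]
  congr!

theorem density_mono {P Q : α → Prop} (h : ∀ x, P x → Q x) : density P ≤ density Q := by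
  classical
  unfold density
  gcongr
  exact h _

theorem density_congr {P Q : α → Prop} (h : ∀ x, P x ↔ Q x) : density P = density Q :=
  congrArg density (funext fun x => propext (h x))

theorem density_le_one (P : α → Prop) : density P ≤ 1 := by
  classical
  unfold density
  apply div_le_one_of_le₀ _ (by positivity)
  exact_mod_cast Finset.card_le_univ _

theorem density_or_le (P Q : α → Prop) : density (fun x => P x ∨ Q x) ≤ density P + density Q := by
  classical
  unfold density
  rw [← add_div]
  gcongr
  rw [← Nat.cast_add, Nat.cast_le]
  refine (Finset.card_le_card (t := Finset.univ.filter P ∪ Finset.univ.filter Q) ?_).trans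
    (Finset.card_union_le _ _)
  intro x hx
  simpa using hx

/-- The union bound. -/
theorem density_exists_le {ι : Type*} (s : Finset ι) (P : ι → α → Prop) :
    density (fun x => ∃ i ∈ s, P i x) ≤ ∑ i ∈ s, density (P i) := by
  classical
  induction s using Finset.induction_on with
  | empty => simp [density]
  | insert a s ha ih =>
    rw [Finset.sum_insert ha]
    refine le_trans ?_ (le_trans (density_or_le _ _) (add_le_add_right ih _))
    refine density_mono fun x hx => ?_
    simpa using hx

theorem density_equiv (e : α ≃ β) (P : β → Prop) : density (fun x => P (e x)) = density P := by
  classical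
  unfold density
  rw [Fintype.card_congr e]
  congr 2
  exact Finset.card_bij (fun x _ => e x) (by simp) (by simp) (fun b hb => ⟨e.symm b, by simpa using hb⟩)

theorem exists_of_density_pos {P : α → Prop} (h : 0 < density P) : ∃ x, P x := by
  classical
  by_contra! hP
  simp [density, hP] at h

theorem exists_of_density_lt {P Q : α → Prop} (h : density Q < density P) : ∃ x, P x ∧ ¬ Q x := by
  by_contra! hP
  exact absurd (density_mono hP) (not_le.mpr h)

/-- The average over the first coordinate of the densities of the fibres. -/
theorem density_prod (P : α × β → Prop) :
    density P = (∑ x, density fun y => P (x, y)) / Fintype.card α := by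
  classical
  unfold density
  rw [Fintype.card_prod, ← Finset.sum_div, div_div, Nat.cast_mul, mul_comm (Fintype.card α : ℝ)]
  congr 1
  rw [← Nat.cast_sum]
  congr 1
  simp only [Finset.card_filter]
  rw [← Finset.univ_product_univ, Finset.sum_product]

theorem density_prod_right (P : α × β → Prop) :
    density P = (∑ y, density fun x => P (x, y)) / Fintype.card β := by
  rw [← density_equiv (Equiv.prodComm β α), density_prod]
  rfl

theorem density_fst [Nonempty β] (P : α → Prop) : density (fun x : α × β => P x.1) = density P := by
  classical
  rw [density_prod]
  have : ∀ x : α, density (fun _ : β => P x) = if P x then 1 else 0 := by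
    intro x
    by_cases h : P x <;> simp [density, h]
  simp_rw [this, density]
  simp

theorem density_cons {n : ℕ} (P : (Fin (n + 1) → α) → Prop) :
    density P = (∑ x, density fun y : Fin n → α => P (Fin.cons x y)) / Fintype.card α := by
  rw [← density_equiv (Fin.consEquiv fun _ : Fin (n + 1) => α), density_prod]
  rfl

theorem density_cons_right {n : ℕ} (P : (Fin (n + 1) → α) → Prop) :
    density P = (∑ y, density fun x : α => P (Fin.cons x y)) / Fintype.card (Fin n → α) := by
  rw [← density_equiv (Fin.consEquiv fun _ : Fin (n + 1) => α), density_prod_right]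
  rfl

/-- Prescribing a pattern on some of the coordinates of a random tuple has the same density as
the pattern. -/
theorem density_comp_injective [Nonempty α] {ι κ : Type*} [Fintype ι] [Fintype κ] [DecidableEq ι]
    [DecidableEq κ] (e : κ → ι) (he : Function.Injective e) (P : (κ → α) → Prop) :
    density (fun x : ι → α => P (x ∘ e)) = density P := by
  classical
  let E : (ι → α) ≃ (κ → α) × ({i // ¬ i ∈ Set.range e} → α) :=
    (Equiv.piEquivPiSubtypeProd (fun i => i ∈ Set.range e) fun _ => α).trans
      (Equiv.prodCongr (Equiv.arrowCongr (Equiv.ofInjective e he).symm (Equiv.refl α))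
        (Equiv.refl _))
  rw [← density_fst (β := {i // ¬ i ∈ Set.range e} → α) P, ← density_equiv E]
  refine density_congr fun x => ?_
  have : (E x).1 = x ∘ e := by
    funext a
    simp [E, Equiv.piEquivPiSubtypeProd]
  rw [this]

/-- Independence of the coordinates of a random tuple. -/
theorem density_forall {s : ℕ} (P : α → Prop) :
    density (fun x : Fin s → α => ∀ a, P (x a)) = density P ^ s := by
  induction s with
  | zero => simp [density]
  | succ s ih =>
    classical
    rw [density_cons, pow_succ]
    simp only [Fin.forall_fin_succ, Fin.cons_zero, Fin.cons_succ]
    have : ∀ x : α, density (fun y : Fin s → α => P x ∧ ∀ a, P (y a))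
        = if P x then density P ^ s else 0 := by
      intro x
      by_cases h : P x
      · simp [h, ih]
      · simp [h, density]
    simp_rw [this, ← Finset.sum_filter, Finset.sum_const, nsmul_eq_mul]
    simp only [density]
    ring

/-- Jensen's inequality for powers of an average. -/
theorem average_pow_le [Nonempty α] (f : α → ℝ) (hf : ∀ x, 0 ≤ f x) (s : ℕ) :
    ((∑ x, f x) / Fintype.card α) ^ s ≤ (∑ x, f x ^ s) / Fintype.card α := by
  rcases s with _ | s
  · simp
  have h := pow_sum_div_card_le_sum_pow (s := Finset.univ) (f := f) (fun i _ => hf i) s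
  have hc : (0 : ℝ) < Fintype.card α := by exact_mod_cast Fintype.card_pos
  rw [Finset.card_univ] at h
  rw [div_pow, pow_succ (Fintype.card α : ℝ), ← div_div]
  gcongr

end Density

/-! ### Blow-ups of dense families of tuples -/

/-- The homomorphism density of a complete `j`-partite `j`-uniform hypergraph with parts of
size `s` in a hypergraph of density `α` is at least `α ^ (s ^ j)`: this is Jensen's inequality, one
coordinate at a time. -/
theorem density_blowup {V : Type*} [Fintype V] [Nonempty V] (s j : ℕ)
    (H : (Fin j → V) → Prop) : density H ^ (s ^ j) ≤
      density fun u : Fin j → Fin s → V => ∀ f : Fin j → Fin s, H fun i => u i (f i) := by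
  induction j with
  | zero =>
    have h : ∀ u : Fin 0 → V, H u ↔ H Fin.elim0 := fun u => by rw [Subsingleton.elim u Fin.elim0]
    have h' : ∀ u : Fin 0 → Fin s → V, (∀ f : Fin 0 → Fin s, H fun i => u i (f i)) ↔ H Fin.elim0 :=
      fun u => ⟨fun g => (h _).1 (g Fin.elim0), fun g f => (h _).2 g⟩
    rw [density_congr h, density_congr h', pow_zero, pow_one]
    by_cases hH : H Fin.elim0 <;> simp [density, hH]
  | succ j ih =>
    let G : (Fin s → V) → (Fin j → V) → Prop := fun x y => ∀ a, H (Fin.cons (x a) y)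
    have key : ∀ (x : Fin s → V) (u : Fin j → Fin s → V),
        (∀ f : Fin (j + 1) → Fin s, H fun i => (Fin.cons x u : Fin (j + 1) → Fin s → V) i (f i)) ↔
          ∀ f : Fin j → Fin s, G x fun i => u i (f i) := by
      intro x u
      have hc : ∀ f : Fin (j + 1) → Fin s,
          (fun i => (Fin.cons x u : Fin (j + 1) → Fin s → V) i (f i)) =
            Fin.cons (x (f 0)) fun i : Fin j => u i (f i.succ) := by
        intro f
        funext i
        refine Fin.cases ?_ (fun i => ?_) i <;> simp
      constructor
      · intro h f a
        have := h (Fin.cons a f)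
        rw [hc] at this
        simpa using this
      · intro h f
        rw [hc]
        exact h (fun i => f i.succ) (f 0)
    rw [density_cons (fun u : Fin (j + 1) → Fin s → V => _),
      Finset.sum_congr rfl fun x _ => density_congr (key x)]
    have h1 : density H ^ s ≤ (∑ x : Fin s → V, density (G x)) / Fintype.card (Fin s → V) := by
      have h2 : ∀ y : Fin j → V, density (fun x : Fin s → V => G x y) =
          density (fun v => H (Fin.cons v y)) ^ s := fun y => density_forall (fun v => H (Fin.cons v y))
      rw [← density_prod (fun z : (Fin s → V) × (Fin j → V) => G z.1 z.2), density_prod_right,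
        Finset.sum_congr rfl fun y _ => h2 y, density_cons_right]
      exact average_pow_le _ (fun _ => density_nonneg _) s
    calc density H ^ s ^ (j + 1) = (density H ^ s) ^ (s ^ j) := by rw [← pow_mul, pow_succ']
      _ ≤ ((∑ x : Fin s → V, density (G x)) / Fintype.card (Fin s → V)) ^ (s ^ j) := by
        gcongr
        exact pow_nonneg (density_nonneg _) _
      _ ≤ (∑ x : Fin s → V, density (G x) ^ (s ^ j)) / Fintype.card (Fin s → V) :=
        average_pow_le _ (fun _ => density_nonneg _) _
      _ ≤ _ := by
        gcongr with x
        exact ih (G x)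

/-! ### Clique tuples and their blow-ups -/

/-- The tuple `y` lists pairwise adjacent (hence distinct) vertices of `Γ`. -/
def IsCliqueTuple {V : Type*} (Γ : SimpleGraph V) {j : ℕ} (y : Fin j → V) : Prop :=
  ∀ i i', i ≠ i' → Γ.Adj (y i) (y i')

section Blowup

variable {V : Type*} [Fintype V] [Nonempty V]

theorem isCliqueTuple_cons {V : Type*} (Γ : SimpleGraph V) {j : ℕ} (v : V) (y : Fin j → V) :
    IsCliqueTuple Γ (Fin.cons v y : Fin (j + 1) → V) ↔
      IsCliqueTuple Γ y ∧ ∀ i, Γ.Adj v (y i) := by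
  constructor
  · intro h
    exact ⟨fun i i' hi => by simpa using h i.succ i'.succ (by simpa using hi),
      fun i => by simpa using h 0 i.succ (Fin.succ_ne_zero i).symm⟩
  · rintro ⟨h, h'⟩ i
    refine Fin.cases (fun i' => ?_) (fun i i' => ?_) i
    · refine Fin.cases (fun hh => absurd rfl hh) (fun i' _ => ?_) i'
      simpa using h' i'
    · refine Fin.cases (fun _ => ?_) (fun i' hi => ?_) i'
      · simpa using (h' i).symm
      · simpa using h i i' (by simpa using hi)

theorem exists_le_density_fiber {α β : Type*} [Fintype α] [Fintype β] [Nonempty β]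
    (P : α × β → Prop) : ∃ y, density P ≤ density fun x => P (x, y) := by
  by_contra! h
  have hc : (0 : ℝ) < Fintype.card β := by exact_mod_cast Fintype.card_pos
  have h1 := Finset.sum_lt_sum_of_nonempty (s := (Finset.univ : Finset β)) Finset.univ_nonempty
    (fun y _ => h y)
  rw [Finset.sum_const, Finset.card_univ, nsmul_eq_mul] at h1
  have h2 := density_prod_right P
  rw [eq_div_iff hc.ne'] at h2
  linarith

theorem density_pair_eq : density (fun y : Fin 2 → V => y 0 = y 1) = 1 / Fintype.card V := by
  classical
  have hc : (0 : ℝ) < Fintype.card V := by exact_mod_cast Fintype.card_pos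
  rw [density_cons]
  have : ∀ x : V, density (fun y : Fin 1 → V =>
      (Fin.cons x y : Fin 2 → V) 0 = (Fin.cons x y : Fin 2 → V) 1) = 1 / Fintype.card V := by
    intro x
    rw [← density_equiv (Equiv.funUnique (Fin 1) V).symm]
    have : ∀ z : V, ((Fin.cons x ((Equiv.funUnique (Fin 1) V).symm z) : Fin 2 → V) 0 =
      (Fin.cons x ((Equiv.funUnique (Fin 1) V).symm z) : Fin 2 → V) 1) ↔ z = x := by
      intro z
      change x = z ↔ z = x
      exact eq_comm
    rw [density_congr this]
    unfold density
    rw [Finset.filter_eq' Finset.univ x]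
    simp
  simp_rw [this]
  simp

/-- Density of a pattern on distinct entries of a random array. -/
theorem density_array_comp {j s : ℕ} {κ : Type*} [Fintype κ] [DecidableEq κ]
    (e : κ → Fin j × Fin s) (he : Function.Injective e) (P : (κ → V) → Prop) :
    density (fun u : Fin j → Fin s → V => P fun x => u (e x).1 (e x).2) = density P := by
  rw [← density_comp_injective e he P, ← density_equiv (Equiv.curry (Fin j) (Fin s) V)]
  rfl

theorem density_array_coincidence {j s : ℕ} (i : Fin j) {a b : Fin s} (hab : a ≠ b) :
    density (fun u : Fin j → Fin s → V => u i a = u i b) = 1 / Fintype.card V := by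
  rw [← density_pair_eq]
  refine density_array_comp (fun x : Fin 2 => if x = 0 then (i, a) else (i, b)) ?_
    (fun y => y 0 = y 1)
  intro x x' h
  fin_cases x <;> fin_cases x' <;> simp_all

theorem density_array_cons {j s : ℕ} (i : Fin j) {a b : Fin s} (hab : a ≠ b)
    (P : (Fin (j + 1) → V) → Prop) :
    density (fun u : Fin j → Fin s → V => P (Fin.cons (u i b) fun i' => u i' a)) = density P := by
  have h := density_array_comp (V := V)
    (Fin.cons (i, b) (fun i' => (i', a)) : Fin (j + 1) → Fin j × Fin s) ?_ P
  · rw [← h]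
    refine density_congr fun u => iff_of_eq (congrArg P ?_)
    funext x
    refine Fin.cases ?_ (fun x => ?_) x <;> simp
  · rw [Fin.cons_injective_iff]
    refine ⟨?_, fun x y h => (Prod.ext_iff.1 h).1⟩
    rintro ⟨x, hx⟩
    exact hab (Prod.ext_iff.1 hx).2

theorem density_array_not_injective (r t : ℕ) :
    density (fun u : Fin r → Fin t → V => ¬ ∀ i, Function.Injective (u i)) ≤
      r * t ^ 2 / Fintype.card V := by
  calc _ ≤ density (fun u : Fin r → Fin t → V =>
        ∃ p ∈ (Finset.univ : Finset (Fin r × Fin t × Fin t)),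
          p.2.1 ≠ p.2.2 ∧ u p.1 p.2.1 = u p.1 p.2.2) := by
        refine density_mono fun u hu => ?_
        simp only [Function.Injective] at hu
        push Not at hu
        obtain ⟨i, a, b, h, hab⟩ := hu
        exact ⟨(i, a, b), Finset.mem_univ _, hab, h⟩
    _ ≤ ∑ p ∈ (Finset.univ : Finset (Fin r × Fin t × Fin t)),
        density (fun u : Fin r → Fin t → V => p.2.1 ≠ p.2.2 ∧ u p.1 p.2.1 = u p.1 p.2.2) :=
        density_exists_le _ _
    _ ≤ ∑ p ∈ (Finset.univ : Finset (Fin r × Fin t × Fin t)), 1 / (Fintype.card V : ℝ) := by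
        refine Finset.sum_le_sum fun p _ => ?_
        by_cases hp : p.2.1 = p.2.2
        · have : density (fun u : Fin r → Fin t → V =>
              p.2.1 ≠ p.2.2 ∧ u p.1 p.2.1 = u p.1 p.2.2) = 0 := by
            simp [density, hp]
          rw [this]; positivity
        · rw [← density_array_coincidence p.1 hp]
          exact density_mono fun u hu => hu.2
    _ = _ := by
      simp only [Finset.sum_const, Finset.card_univ, Fintype.card_prod, Fintype.card_fin,
        nsmul_eq_mul]
      push_cast; ring

/-- A dense family of `j`-cliques in a graph with few `(j + 1)`-cliques contains all transversals of
some `j` independent sets of size `s`. An edge inside a part would extend a transversal to a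
`(j + 1)`-clique, so few arrays contain one. -/
theorem exists_blowup_independent (Γ : SimpleGraph V) {j s : ℕ} (H : (Fin j → V) → Prop)
    (hH : ∀ y, H y → IsCliqueTuple Γ y) {α c : ℝ} (hα : 0 ≤ α) (hαH : α ≤ density H)
    (hc : density (fun y : Fin (j + 1) → V => IsCliqueTuple Γ y) ≤ c)
    (hs : j * s ^ 2 * (c + 1 / Fintype.card V) < α ^ (s ^ j)) :
    ∃ u : Fin j → Fin s → V, (∀ f : Fin j → Fin s, H fun i => u i (f i)) ∧
      ∀ i a b, a ≠ b → u i a ≠ u i b ∧ ¬ Γ.Adj (u i a) (u i b) := by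
  classical
  let B : Fin j × Fin s × Fin s → (Fin j → Fin s → V) → Prop := fun p u =>
    p.2.1 ≠ p.2.2 ∧ (u p.1 p.2.1 = u p.1 p.2.2 ∨
      IsCliqueTuple Γ (Fin.cons (u p.1 p.2.2) fun i' => u i' p.2.1 : Fin (j + 1) → V))
  have hc0 : 0 ≤ c := (density_nonneg _).trans hc
  have hB : ∀ p, density (B p) ≤ c + 1 / Fintype.card V := by
    rintro ⟨i, a, b⟩
    by_cases hab : a = b
    · have : density (B (i, a, b)) = 0 := by simp [density, B, hab]
      rw [this]; positivity
    · calc density (B (i, a, b)) ≤ density (fun u : Fin j → Fin s → V => u i a = u i b ∨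
            IsCliqueTuple Γ (Fin.cons (u i b) fun i' => u i' a : Fin (j + 1) → V)) :=
            density_mono fun u hu => hu.2
        _ ≤ _ := density_or_le _ _
        _ ≤ _ := by
          rw [density_array_coincidence i hab,
            density_array_cons i hab (fun y => IsCliqueTuple Γ y), add_comm]
          exact add_le_add_left hc _
  have hBall : density (fun u => ∃ p ∈ (Finset.univ : Finset (Fin j × Fin s × Fin s)), B p u) <
      density fun u : Fin j → Fin s → V => ∀ f : Fin j → Fin s, H fun i => u i (f i) := by
    calc _ ≤ ∑ p ∈ (Finset.univ : Finset (Fin j × Fin s × Fin s)), density (B p) :=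
          density_exists_le _ _
      _ ≤ ∑ p ∈ (Finset.univ : Finset (Fin j × Fin s × Fin s)), (c + 1 / Fintype.card V) :=
          Finset.sum_le_sum fun p _ => hB p
      _ = j * s ^ 2 * (c + 1 / Fintype.card V) := by
        simp only [Finset.sum_const, Finset.card_univ, Fintype.card_prod, Fintype.card_fin,
          nsmul_eq_mul]
        push_cast; ring
      _ < α ^ (s ^ j) := hs
      _ ≤ density H ^ (s ^ j) := by gcongr
      _ ≤ _ := density_blowup s j H
  obtain ⟨u, hu, hu'⟩ := exists_of_density_lt hBall
  refine ⟨u, hu, fun i a b hab => ⟨fun h => hu' ⟨(i, a, b), Finset.mem_univ _, hab, Or.inl h⟩,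
    fun h => hu' ⟨(i, a, b), Finset.mem_univ _, hab, Or.inr ?_⟩⟩⟩
  rw [isCliqueTuple_cons]
  refine ⟨hH _ (hu fun _ => a), fun i' => ?_⟩
  by_cases hi : i' = i
  · subst hi; exact h.symm
  · have := hH _ (hu fun x => if x = i then b else a) i i' (Ne.symm hi)
    simpa [hi] using this

/-- Many `(r + 1)`-cliques force a complete `(r + 1)`-partite graph with `r` parts of bounded size
and one part of linear size. -/
theorem exists_blowup_linear_part (Γ : SimpleGraph V) {r t : ℕ} {c : ℝ} (hc0 : 0 ≤ c)
    (hc : c ≤ density (fun y : Fin (r + 1) → V => IsCliqueTuple Γ y))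
    (hpos : 0 < c ^ (t ^ r) - r * t ^ 2 / Fintype.card V) :
    ∃ u : Fin r → Fin t → V, (∀ f : Fin r → Fin t, IsCliqueTuple Γ fun i => u i (f i)) ∧
      (∀ i, Function.Injective (u i)) ∧
      c ^ (t ^ r) - r * t ^ 2 / Fintype.card V ≤
        density fun z => ∀ f : Fin r → Fin t, ∀ i, Γ.Adj z (u i (f i)) := by
  have hcard : (0 : ℝ) < Fintype.card V := by exact_mod_cast Fintype.card_pos
  let A : V × (Fin r → Fin t → V) → Prop := fun q =>
    ∀ f : Fin r → Fin t, IsCliqueTuple Γ (Fin.cons q.1 fun i => q.2 i (f i) : Fin (r + 1) → V)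
  let B : V × (Fin r → Fin t → V) → Prop := fun q => ∀ i, Function.Injective (q.2 i)
  have hA : c ^ (t ^ r) ≤ density A := by
    rw [density_prod]
    refine le_trans ?_ (b := (∑ z : V, density (fun y : Fin r → V =>
      IsCliqueTuple Γ (Fin.cons z y : Fin (r + 1) → V)) ^ (t ^ r)) / Fintype.card V) ?_
    · refine le_trans ?_ (average_pow_le _ (fun _ => density_nonneg _) _)
      rw [← density_cons (fun y : Fin (r + 1) → V => IsCliqueTuple Γ y)]
      gcongr
    · gcongr with z
      exact density_blowup t r fun y => IsCliqueTuple Γ (Fin.cons z y : Fin (r + 1) → V)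
  have hB : density (fun q => ¬ B q) ≤ r * t ^ 2 / Fintype.card V := by
    refine le_trans ?_ (density_array_not_injective r t)
    have h1 := density_fst (β := V)
      fun u : Fin r → Fin t → V => ¬ ∀ i, Function.Injective (u i)
    rw [← h1]
    exact (density_equiv (Equiv.prodComm V (Fin r → Fin t → V)) fun q =>
      ¬ ∀ i, Function.Injective (q.1 i)).le
  have hAB : c ^ (t ^ r) - r * t ^ 2 / Fintype.card V ≤ density fun q => A q ∧ B q := by
    have : density A ≤ density (fun q => A q ∧ B q) + density fun q => ¬ B q := by
      refine le_trans (density_mono fun q hq => ?_) (density_or_le _ _)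
      by_cases h : B q
      · exact Or.inl ⟨hq, h⟩
      · exact Or.inr h
    linarith
  obtain ⟨u, hu⟩ := exists_le_density_fiber (fun q => A q ∧ B q)
  have hu' := hAB.trans hu
  obtain ⟨z, hz⟩ := exists_of_density_pos (hpos.trans_le hu')
  refine ⟨u, fun f => ((isCliqueTuple_cons Γ _ _).1 (hz.1 f)).1, hz.2, hu'.trans ?_⟩
  exact density_mono fun z hz f => ((isCliqueTuple_cons Γ _ _).1 (hz.1 f)).2

end Blowup

/-! ### From nearly complete pairs to the multipartite graph -/

/-- No independent `k`-set of `Γ` has `n` vertices (its own members included) without neighbours in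
it; this says that the complement of `Γ` contains no book `B_{k,n}`. -/
def ComplBookFree {V : Type*} [Fintype V] (Γ : SimpleGraph V) (k n : ℕ) : Prop :=
  ∀ g : Fin k → V, (∀ a b, a ≠ b → g a ≠ g b ∧ ¬ Γ.Adj (g a) (g b)) →
    ∀ S : Finset V, (∀ v ∈ S, ∀ a, ¬ Γ.Adj v (g a)) → S.card < n

/-- `Γ` has pairwise completely joined vertex sets of at least the sizes `a 1, …, a p`. -/
def HasParts {V : Type*} (Γ : SimpleGraph V) (p : ℕ) (a : ℕ → ℕ) : Prop :=
  ∃ B : Fin p → Finset V, (∀ i : Fin p, a (i.val + 1) ≤ (B i).card) ∧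
    ∀ i j, i < j → ∀ x ∈ B i, ∀ y ∈ B j, Γ.Adj x y

section NearlyComplete

variable {V : Type*} [Fintype V]

open Classical in
/-- If all `i`-blocks are hit by every `v` that is nearly joined to the others, a vertex is charged
to the classes `i` of which it hits at most half of the blocks. A vertex charged only to `i` has
no neighbour in class `i`; every other vertex is charged twice, so each vertex misses at least `q`
blocks in total, which is too much for a graph whose complement has no book. -/
theorem false_of_blocks (Γ : SimpleGraph V) {r k n q : ℕ} (hq : 0 < q) (hr : 0 < r)
    (hN : r * (n - 1) < Fintype.card V) (hbook : ComplBookFree Γ k n)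
    (f : Fin r → Fin q → Fin k → V) (hf : ∀ i a, Function.Injective (f i a))
    (hQ : ∀ i a b j, j ≠ i →
      q < 2 * (Finset.univ.filter fun c => ∃ d, Γ.Adj (f i a b) (f j c d)).card)
    (hP : ∀ i a b u, Γ.Adj u (f i a b) → ¬ ∀ j, j ≠ i →
      q < 2 * (Finset.univ.filter fun c => ∃ d, Γ.Adj u (f j c d)).card) : False := by
  let hits : V → Fin r → Finset (Fin q) := fun v j =>
    Finset.univ.filter fun c => ∃ d, Γ.Adj v (f j c d)
  let miss : V → Fin r → Finset (Fin q) := fun v j =>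
    Finset.univ.filter fun c => ¬ ∃ d, Γ.Adj v (f j c d)
  have hsum : ∀ v j, (hits v j).card + (miss v j).card = q := fun v j => by
    have := Finset.card_filter_add_card_filter_not (s := (Finset.univ : Finset (Fin q)))
      (fun c => ∃ d, Γ.Adj v (f j c d))
    rwa [Finset.card_univ, Fintype.card_fin] at this
  have hzero : ∀ v i, (∀ j, j ≠ i → q < 2 * (hits v j).card) → hits v i = ∅ := by
    intro v i h
    by_contra hne
    obtain ⟨c, hc⟩ := Finset.nonempty_iff_ne_empty.2 hne
    obtain ⟨d, hd⟩ := (Finset.mem_filter.1 hc).2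
    exact hP i c d v hd h
  have hmiss : ∀ v, q ≤ ∑ j, (miss v j).card := by
    intro v
    by_cases h2 : ∃ i i', i ≠ i' ∧ 2 * (hits v i).card ≤ q ∧ 2 * (hits v i').card ≤ q
    · obtain ⟨i, i', hii, h1, h2⟩ := h2
      have hle : (miss v i).card + (miss v i').card ≤ ∑ j, (miss v j).card := by
        rw [← Finset.sum_pair (f := fun j => (miss v j).card) hii]
        exact Finset.sum_le_sum_of_subset (Finset.subset_univ _)
      have := hsum v i
      have := hsum v i'
      omega
    · push Not at h2
      obtain ⟨i, hi⟩ : ∃ i, ∀ j, j ≠ i → q < 2 * (hits v j).card := by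
        by_cases h1 : ∃ i, 2 * (hits v i).card ≤ q
        · obtain ⟨i, hi⟩ := h1
          exact ⟨i, fun j hj => h2 i j (Ne.symm hj) hi⟩
        · push Not at h1
          exact ⟨⟨0, hr⟩, fun j _ => h1 j⟩
      have h0 := hzero v i hi
      have h1 := hsum v i
      rw [h0, Finset.card_empty, zero_add] at h1
      calc q = (miss v i).card := h1.symm
        _ ≤ _ := Finset.single_le_sum (f := fun j => (miss v j).card) (fun _ _ => Nat.zero_le _)
          (Finset.mem_univ i)
  have hblock : ∀ i c, (Finset.univ.filter fun v => c ∈ miss v i).card ≤ n - 1 := by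
    intro i c
    have := hbook (f i c) (fun a b hab => ⟨fun h => hab (hf i c h), fun h => ?_⟩)
      (Finset.univ.filter fun v => c ∈ miss v i) ?_
    · omega
    · have h0 := hzero (f i c a) i (hQ i c a)
      have : c ∈ hits (f i c a) i := Finset.mem_filter.2 ⟨Finset.mem_univ _, b, h⟩
      rw [h0] at this
      simp at this
    · intro v hv a ha
      exact (Finset.mem_filter.1 (Finset.mem_filter.1 hv).2).2 ⟨a, ha⟩
  have h1 : Fintype.card V * q ≤ ∑ v : V, ∑ j, (miss v j).card := by
    calc Fintype.card V * q = ∑ v : V, q := by simp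
      _ ≤ _ := Finset.sum_le_sum fun v _ => hmiss v
  have h2 : ∑ v : V, ∑ j, (miss v j).card ≤ r * (q * (n - 1)) := by
    rw [Finset.sum_comm]
    calc _ ≤ ∑ j : Fin r, q * (n - 1) := by
          refine Finset.sum_le_sum fun j _ => ?_
          have : ∑ v : V, (miss v j).card =
              ∑ c : Fin q, (Finset.univ.filter fun v => c ∈ miss v j).card := by
            have hm : ∀ v, (miss v j).card = ∑ c, if c ∈ miss v j then 1 else 0 := fun v => by
              rw [← Finset.card_filter]
              congr 1
              ext c
              simp
            simp_rw [hm, Finset.card_filter]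
            rw [Finset.sum_comm]
          rw [this]
          calc _ ≤ ∑ c : Fin q, (n - 1) := Finset.sum_le_sum fun c _ => hblock j c
            _ = _ := by simp
      _ = _ := by simp
  have h3 : Fintype.card V * q ≤ (r * (n - 1)) * q := by
    calc _ ≤ _ := h1.trans h2
      _ = _ := by ring
  exact absurd (Nat.le_of_mul_le_mul_right h3 hq) (not_le.2 hN)

open Classical in
/-- Greedy choice of pairwise completely joined sets `B i ⊆ C i`: each vertex chosen so far excludes at
most `h` vertices of any later `C j`, and at most `j * t` vertices precede step `j`. -/
theorem exists_greedy_parts {V : Type*} (Γ : SimpleGraph V) (t h : ℕ) (b : ℕ → ℕ) (C : ℕ → Finset V) (d : ℕ)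
    (hb : ∀ i, i + 1 < d → b i ≤ t)
    (hC : ∀ i j, i < j → j < d → ∀ v ∈ C i, ((C j).filter fun x => ¬ Γ.Adj v x).card ≤ h)
    (hsize : ∀ j, j < d → b j + j * t * h ≤ (C j).card) :
    ∃ B : ℕ → Finset V, (∀ i, i < d → B i ⊆ C i ∧ (B i).card = b i) ∧
      ∀ i j, i < j → j < d → ∀ x ∈ B i, ∀ y ∈ B j, Γ.Adj x y := by
  induction d with
  | zero => exact ⟨fun _ => ∅, by simp, by simp⟩
  | succ d ih =>
    obtain ⟨B, hB, hBB⟩ := ih (fun i hi => hb i (by omega)) (fun i j hij hj => hC i j hij (by omega))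
      (fun j hj => hsize j (by omega))
    let R : Finset V := (Finset.range d).biUnion fun i =>
      (B i).biUnion fun v => (C d).filter fun x => ¬ Γ.Adj v x
    have hR : R.card ≤ d * t * h := by
      calc R.card ≤ ∑ i ∈ Finset.range d, ((B i).biUnion fun v =>
            (C d).filter fun x => ¬ Γ.Adj v x).card := Finset.card_biUnion_le
        _ ≤ ∑ i ∈ Finset.range d, t * h := by
          refine Finset.sum_le_sum fun i hi => ?_
          have hi := Finset.mem_range.1 hi
          refine Finset.card_biUnion_le.trans ?_
          refine (Finset.sum_le_card_nsmul _ _ h fun v hv =>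
            hC i d hi (by omega) v ((hB i hi).1 hv)).trans ?_
          rw [(hB i hi).2, smul_eq_mul]
          exact Nat.mul_le_mul_right _ (hb i (by omega))
        _ = _ := by simp [mul_assoc]
    obtain ⟨D, hD, hDc⟩ := Finset.exists_subset_card_eq (s := C d \ R) (n := b d) (by
      have := Finset.le_card_sdiff R (C d)
      have := hsize d (by omega)
      omega)
    refine ⟨fun i => if i = d then D else B i, fun i hi => ?_, fun i j hij hj x hx y hy => ?_⟩
    · by_cases hid : i = d
      · subst hid
        simpa using ⟨hD.trans Finset.sdiff_subset, hDc⟩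
      · simpa [hid] using hB i (by omega)
    · simp only at hx hy
      rw [if_neg (by omega)] at hx
      by_cases hjd : j = d
      · subst hjd
        rw [if_pos rfl] at hy
        by_contra hadj
        have hyD := Finset.mem_sdiff.1 (hD hy)
        exact hyD.2 (Finset.mem_biUnion.2 ⟨i, Finset.mem_range.2 hij,
          Finset.mem_biUnion.2 ⟨x, hx, Finset.mem_filter.2 ⟨hyD.1, hadj⟩⟩⟩)
      · rw [if_neg hjd] at hy
        exact hBB i j hij (by omega) x hx y hy

open Classical in
/-- Linear-sized sets that are pairwise nearly complete contain, together with any edge `uw` such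
that `w` is in one of them and `u` has many neighbours in the others, the multipartite graph. -/
theorem hasParts_of_edge {V : Type*} (Γ : SimpleGraph V) {r t h m : ℕ} {a : ℕ → ℕ} (ha1 : a 1 = 1)
    (ha2 : a 2 = 1) (hat : ∀ i, i + 1 < r → a (i + 3) ≤ t) (ham : ∀ i, i < r → a (i + 3) ≤ m)
    (T : Fin (r + 1) → Finset V)
    (hT : ∀ i j, j ≠ i → ∀ v ∈ T i, ((T j).filter fun x => ¬ Γ.Adj v x).card ≤ h)
    (i : Fin (r + 1)) {u w : V} (huw : Γ.Adj u w) (hw : w ∈ T i)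
    (hu : ∀ j, j ≠ i → m + (r * t + 1) * h ≤ ((T j).filter fun x => Γ.Adj u x).card) :
    HasParts Γ (r + 2) a := by
  let C : ℕ → Finset V := fun j => if hj : j < r then
    (T (i.succAbove ⟨j, hj⟩)).filter fun x => Γ.Adj u x ∧ Γ.Adj w x else ∅
  have hCT : ∀ j (hj : j < r), C j ⊆ T (i.succAbove ⟨j, hj⟩) := by
    intro j hj x hx
    simp only [C, dif_pos hj] at hx
    exact (Finset.mem_filter.1 hx).1
  have hCuw : ∀ j, j < r → ∀ x ∈ C j, Γ.Adj u x ∧ Γ.Adj w x := by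
    intro j hj x hx
    simp only [C, dif_pos hj] at hx
    exact (Finset.mem_filter.1 hx).2
  have hCcard : ∀ j, j < r → m + r * t * h ≤ (C j).card := by
    intro j hj
    have hne := Fin.succAbove_ne i ⟨j, hj⟩
    have h1 := hu _ hne
    have h2 := hT i _ hne w hw
    have h3 : (T (i.succAbove ⟨j, hj⟩)).filter (fun x => Γ.Adj u x) ⊆
        C j ∪ (T (i.succAbove ⟨j, hj⟩)).filter fun x => ¬ Γ.Adj w x := by
      intro x hx
      rw [Finset.mem_filter] at hx
      simp only [C, dif_pos hj, Finset.mem_union, Finset.mem_filter]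
      tauto
    have h4 := (Finset.card_le_card h3).trans (Finset.card_union_le _ _)
    nlinarith
  obtain ⟨B, hB, hBB⟩ := exists_greedy_parts Γ t h (fun j => a (j + 3)) C r hat
    (fun i' j hij hj v hv => by
      refine (Finset.card_le_card ?_).trans
        (hT (i.succAbove ⟨i', hij.trans hj⟩) (i.succAbove ⟨j, hj⟩) ?_ v (hCT i' _ hv))
      · exact Finset.filter_subset_filter _ (hCT j hj)
      · intro he
        have := Fin.succAbove_right_injective he
        simp only [Fin.mk.injEq] at this
        omega)
    (fun j hj => by
      have h1 := hCcard j hj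
      have h2 := ham j hj
      have h3 : j * t * h ≤ r * t * h := by gcongr
      omega)
  refine ⟨Fin.cons {u} (Fin.cons {w} fun j : Fin r => B j), fun x => ?_, fun x y => ?_⟩
  · refine Fin.cases (by simp [ha1]) (fun x => ?_) x
    refine Fin.cases (by simp [ha2]) (fun x => ?_) x
    simp [(hB x.val x.2).2]
  · refine Fin.cases ?_ (fun x => ?_) x <;> refine Fin.cases ?_ (fun y => ?_) y
    · intro h; exact absurd h (lt_irrefl _)
    · intro _ z hz z' hz'
      simp only [Fin.cons_zero, Finset.mem_singleton] at hz
      subst hz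
      revert hz'
      refine Fin.cases ?_ (fun y => ?_) y
      · intro hz'
        simp only [Fin.cons_succ, Fin.cons_zero, Finset.mem_singleton] at hz'
        subst hz'
        exact huw
      · intro hz'
        simp only [Fin.cons_succ] at hz'
        exact (hCuw y.val y.2 _ ((hB y.val y.2).1 hz')).1
    · intro h; exact absurd h (Fin.not_lt_zero _)
    · intro h
      rw [Fin.succ_lt_succ_iff] at h
      intro z hz z' hz'
      rw [Fin.cons_succ] at hz hz'
      revert h hz hz'
      refine Fin.cases ?_ (fun x => ?_) x <;> refine Fin.cases ?_ (fun y => ?_) y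
      · intro h; exact absurd h (lt_irrefl _)
      · intro _ hz hz'
        simp only [Fin.cons_succ, Fin.cons_zero, Finset.mem_singleton] at hz hz'
        subst hz
        exact (hCuw y.val y.2 _ ((hB y.val y.2).1 hz')).2
      · intro h; exact absurd h (Fin.not_lt_zero _)
      · intro h hz hz'
        simp only [Fin.cons_succ] at hz hz'
        rw [Fin.succ_lt_succ_iff] at h
        exact hBB x.val y.val h y.2 _ hz _ hz'

open Classical in
/-- Linear-sized sets that are pairwise nearly complete, in a graph on more than `(r + 1) * (n - 1)`
vertices whose complement contains no book, force the multipartite graph. -/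
theorem hasParts_of_nearly_complete (Γ : SimpleGraph V) {r k n t h m q : ℕ} {a : ℕ → ℕ}
    (hk : 0 < k) (ha1 : a 1 = 1) (ha2 : a 2 = 1) (hat : ∀ i, i + 1 < r → a (i + 3) ≤ t)
    (ham : ∀ i, i < r → a (i + 3) ≤ m) (hN : (r + 1) * (n - 1) < Fintype.card V)
    (hbook : ComplBookFree Γ k n) (T : Fin (r + 1) → Finset V)
    (hTcard : ∀ i, q * k ≤ (T i).card)
    (hT : ∀ i j, j ≠ i → ∀ v ∈ T i, ((T j).filter fun x => ¬ Γ.Adj v x).card ≤ h)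
    (hm : 0 < m) (hq : 2 * (m + (r * t + 1) * h) ≤ q) :
    HasParts Γ (r + 2) a := by
  by_contra hG
  have hemb : ∀ i, ∃ g : Fin q × Fin k → V, Function.Injective g ∧ ∀ x, g x ∈ T i := by
    intro i
    obtain ⟨D, hD, hDc⟩ := Finset.exists_subset_card_eq (hTcard i)
    have e : Fin q × Fin k ≃ D := Fintype.equivOfCardEq (by simp [hDc])
    exact ⟨fun x => (e x : V), fun x y hxy => e.injective (Subtype.ext hxy), fun x => hD (e x).2⟩
  choose g hg hgT using hemb
  refine false_of_blocks Γ (q := q) (by omega) (Nat.succ_pos r) hN hbook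
    (fun i c d => g i (c, d)) (fun i c d d' hdd => (Prod.ext_iff.1 (hg i hdd)).2) ?_ ?_
  · intro i c d j hj
    have h1 := Finset.card_filter_add_card_filter_not (s := (Finset.univ : Finset (Fin q)))
      (fun c' => ∃ d', Γ.Adj (g i (c, d)) (g j (c', d')))
    have h2 : (Finset.univ.filter fun c' => ¬ ∃ d', Γ.Adj (g i (c, d)) (g j (c', d'))).card ≤
        ((T j).filter fun x => ¬ Γ.Adj (g i (c, d)) x).card := by
      refine Finset.card_le_card_of_injOn (fun c' => g j (c', ⟨0, hk⟩)) (fun c' hc' => ?_)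
        fun c' _ c'' _ hcc => (Prod.ext_iff.1 (hg j hcc)).1
      have hc' := (Finset.mem_filter.1 hc').2
      exact Finset.mem_coe.2 (Finset.mem_filter.2 ⟨hgT j _, fun hadj => hc' ⟨_, hadj⟩⟩)
    have h3 := h2.trans (hT i j hj _ (hgT i (c, d)))
    rw [Finset.card_univ, Fintype.card_fin] at h1
    nlinarith [Nat.zero_le (r * t * h)]
  · intro i c d u hadj hall
    refine hG (hasParts_of_edge Γ ha1 ha2 hat ham T hT i hadj (hgT i (c, d)) fun j hj => ?_)
    have h1 := hall j hj
    have h2 : (Finset.univ.filter fun c' => ∃ d', Γ.Adj u (g j (c', d'))).card ≤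
        ((T j).filter fun x => Γ.Adj u x).card := by
      have hch : ∀ c' : Fin q, ∃ d', (∃ d', Γ.Adj u (g j (c', d'))) → Γ.Adj u (g j (c', d')) := by
        intro c'
        by_cases hc : ∃ d', Γ.Adj u (g j (c', d'))
        · exact ⟨hc.choose, fun _ => hc.choose_spec⟩
        · exact ⟨⟨0, hk⟩, fun hc' => absurd hc' hc⟩
      choose D hD using hch
      refine Finset.card_le_card_of_injOn (fun c' => g j (c', D c')) (fun c' hc' => ?_)
        fun c' _ c'' _ hcc => (Prod.ext_iff.1 (hg j hcc)).1
      exact Finset.mem_coe.2 (Finset.mem_filter.2 ⟨hgT j _, hD c' (Finset.mem_filter.1 hc').2⟩)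
    omega

end NearlyComplete

/-! ### Extracting nearly complete pairs -/

section Averages

variable {α β : Type*} [Fintype α] [Fintype β]

theorem density_split (P Q : α → Prop) :
    density P = density (fun x => P x ∧ Q x) + density fun x => P x ∧ ¬ Q x := by
  classical
  unfold density
  rw [← add_div, ← Nat.cast_add]
  have h := Finset.card_filter_add_card_filter_not (s := Finset.univ.filter P) Q
  rw [Finset.filter_filter, Finset.filter_filter] at h
  rw [← h]
  congr!

/-- Markov's inequality. -/
theorem mul_density_le_average {f : α → ℝ} (hf : ∀ x, 0 ≤ f x) (θ : ℝ) :
    θ * density (fun x => θ ≤ f x) ≤ (∑ x, f x) / Fintype.card α := by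
  classical
  unfold density
  rw [← mul_div_assoc]
  gcongr
  calc θ * (Finset.univ.filter fun x => θ ≤ f x).card
      = ∑ x ∈ Finset.univ.filter fun x => θ ≤ f x, θ := by simp [mul_comm]
    _ ≤ ∑ x ∈ Finset.univ.filter fun x => θ ≤ f x, f x :=
      Finset.sum_le_sum fun x hx => (Finset.mem_filter.1 hx).2
    _ ≤ ∑ x, f x := Finset.sum_le_sum_of_subset_of_nonneg (Finset.filter_subset _ _)
      fun x _ _ => hf x

theorem average_le [Nonempty α] {f : α → ℝ} {c : ℝ} (hf : ∀ x, f x ≤ c) :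
    (∑ x, f x) / Fintype.card α ≤ c := by
  have hc : (0 : ℝ) < Fintype.card α := by exact_mod_cast Fintype.card_pos
  rw [div_le_iff₀ hc]
  calc ∑ x, f x ≤ ∑ _x : α, c := Finset.sum_le_sum fun x _ => hf x
    _ = _ := by simp [mul_comm]

theorem average_le_mul_density {f : α → ℝ} {c : ℝ} {R : α → Prop}
    (hR : ∀ x, R x → f x ≤ c) (hnR : ∀ x, ¬ R x → f x ≤ 0) :
    (∑ x, f x) / Fintype.card α ≤ c * density R := by
  classical
  unfold density
  rw [← mul_div_assoc]
  gcongr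
  calc ∑ x, f x ≤ ∑ x, if R x then c else 0 := by
        refine Finset.sum_le_sum fun x _ => ?_
        split_ifs with h
        · exact hR x h
        · exact hnR x h
    _ = _ := by rw [← Finset.sum_filter, Finset.sum_const, nsmul_eq_mul, mul_comm]

theorem density_false_le {P : α → Prop} (h : ∀ x, ¬ P x) : density P ≤ 0 := by
  simp [density, h]

end Averages

section Cleaning

variable {V : Type*} [Fintype V] [Nonempty V]

/-- The key averaging: if `A` is sparse and nearly as large as the bound `ν` on the common
non-neighbourhoods of independent `k`-sets, then few vertices outside `A` have many non-neighbours
in `A`. A random `k`-tuple of `A` is independent, and its common non-neighbourhood is used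
up by `A` itself. -/
theorem density_outside_le (Γ : SimpleGraph V) {k : ℕ} {ν ω γ η : ℝ} (hν0 : 0 ≤ ν)
    (hν : ∀ g : Fin k → V, (∀ a b, a ≠ b → g a ≠ g b ∧ ¬ Γ.Adj (g a) (g b)) →
      density (fun v => ∀ a, ¬ Γ.Adj v (g a)) ≤ ν) (hω : 0 ≤ ω) (hη : 0 < η) (A : V → Prop)
    (hA : ν - ω ≤ density A)
    (hγ : density (fun q : V × V => A q.1 ∧ A q.2 ∧ Γ.Adj q.1 q.2) ≤ γ) :
    density (fun v => ¬ A v ∧ η ≤ density fun x => A x ∧ ¬ Γ.Adj v x) ≤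
      (ω + k ^ 2 * (γ + 1 / Fintype.card V) + k * γ) / η ^ k := by
  set M := density A with hM
  have hM0 : 0 ≤ M := density_nonneg _
  have hM1 : M ≤ 1 := density_le_one _
  have hγ0 : 0 ≤ γ := (density_nonneg _).trans hγ
  have hγ' : density (fun y : Fin 2 → V => A (y 0) ∧ A (y 1) ∧ Γ.Adj (y 0) (y 1)) ≤ γ := by
    rw [← density_equiv (finTwoArrowEquiv V)] at hγ
    exact hγ
  let F : (Fin (k + 1) → V) → Prop := fun w => ∀ a : Fin k, A (w a.succ) ∧ ¬ Γ.Adj (w 0) (w a.succ)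
  have hall : density F ≤ ν * M ^ k + k ^ 2 * (γ + 1 / Fintype.card V) := by
    let bad : Fin k × Fin k → (Fin k → V) → Prop := fun p x => p.1 ≠ p.2 ∧
      (x p.1 = x p.2 ∨ (A (x p.1) ∧ A (x p.2) ∧ Γ.Adj (x p.1) (x p.2)))
    have hbad : density (fun x => ∃ p ∈ (Finset.univ : Finset (Fin k × Fin k)), bad p x) ≤
        k ^ 2 * (γ + 1 / Fintype.card V) := by
      refine (density_exists_le _ _).trans ?_
      calc _ ≤ ∑ p : Fin k × Fin k, (γ + 1 / (Fintype.card V : ℝ)) := by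
            refine Finset.sum_le_sum fun p _ => ?_
            obtain ⟨a, b⟩ := p
            by_cases hab : a = b
            · refine (density_false_le fun x hx => hx.1 hab).trans (by positivity)
            · have he : Function.Injective (fun i : Fin 2 => if i = 0 then a else b) := by
                intro i i' h
                fin_cases i <;> fin_cases i' <;> simp_all
              refine (density_mono fun x hx => hx.2).trans ((density_or_le _ _).trans ?_)
              have h1 := density_comp_injective (α := V) _ he (fun y => y 0 = y 1)
              have h2 := density_comp_injective (α := V) _ he
                (fun y => A (y 0) ∧ A (y 1) ∧ Γ.Adj (y 0) (y 1))
              rw [density_pair_eq] at h1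
              simp only [Function.comp, if_true, one_ne_zero, if_false] at h1 h2
              simp only
              rw [h1, h2, add_comm]
              gcongr
        _ = _ := by
          simp only [Finset.sum_const, Finset.card_univ, Fintype.card_prod, Fintype.card_fin,
            nsmul_eq_mul]
          push_cast; ring
    let R : (Fin k → V) → Prop := fun x => ∃ p ∈ (Finset.univ : Finset (Fin k × Fin k)), bad p x
    rw [density_split F fun w => R (Fin.tail w)]
    rw [add_comm]
    refine add_le_add ?_ ?_
    · rw [density_cons_right, ← density_forall]
      refine average_le_mul_density (fun x hx => ?_) fun x hx => density_false_le fun v hv => ?_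
      · by_cases hR : R x
        · exact (density_false_le fun v hv => hv.2 (by simpa using hR)).trans hν0
        · refine le_trans (density_mono fun v hv a => ?_) (hν x fun a b hab => ⟨fun h => ?_, fun h => ?_⟩)
          · simpa using (hv.1 a).2
          · exact hR ⟨(a, b), Finset.mem_univ _, hab, Or.inl h⟩
          · exact hR ⟨(a, b), Finset.mem_univ _, hab, Or.inr ⟨hx a, hx b, h⟩⟩
      · exact hx fun a => by simpa using (hv.1 a).1
    · refine le_trans (density_mono fun w hw => hw.2) (le_trans ?_ hbad)
      exact (density_comp_injective Fin.succ (Fin.succ_injective k) R).le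
  have hin : M ^ (k + 1) ≤ density (fun w => F w ∧ A (w 0)) + k * γ := by
    rw [hM, ← density_forall]
    have h1 : density (fun w : Fin (k + 1) → V => ∀ a, A (w a)) ≤ density (fun w =>
        (F w ∧ A (w 0)) ∨ ∃ a ∈ (Finset.univ : Finset (Fin k)),
          A (w 0) ∧ A (w a.succ) ∧ Γ.Adj (w 0) (w a.succ)) := by
      refine density_mono fun w hw => ?_
      by_cases h : ∃ a : Fin k, Γ.Adj (w 0) (w a.succ)
      · obtain ⟨a, ha⟩ := h
        exact Or.inr ⟨a, Finset.mem_univ _, hw _, hw _, ha⟩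
      · push Not at h
        exact Or.inl ⟨fun a => ⟨hw _, h a⟩, hw _⟩
    refine h1.trans ((density_or_le _ _).trans ?_)
    gcongr
    refine (density_exists_le _ _).trans ?_
    calc _ ≤ ∑ a : Fin k, γ := by
          refine Finset.sum_le_sum fun a _ => ?_
          have he : Function.Injective (fun i : Fin 2 => if i = 0 then 0 else a.succ) := by
            intro i i' h
            fin_cases i <;> fin_cases i' <;> simp_all
            exact absurd h.symm (Fin.succ_ne_zero a)
          refine le_trans (le_of_eq ?_) hγ'
          exact density_comp_injective (α := V) _ he
            (fun y => A (y 0) ∧ A (y 1) ∧ Γ.Adj (y 0) (y 1))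
      _ = _ := by simp
  have hout : η ^ k * density (fun v => ¬ A v ∧ η ≤ density fun x => A x ∧ ¬ Γ.Adj v x) ≤
      density fun w => F w ∧ ¬ A (w 0) := by
    rw [density_cons]
    refine le_trans ?_ (mul_density_le_average (fun _ => density_nonneg _) (η ^ k))
    gcongr
    refine density_mono fun v hv => ?_
    have h1 : density (fun y : Fin k → V => ∀ a, A (y a) ∧ ¬ Γ.Adj v (y a)) =
        (density fun x => A x ∧ ¬ Γ.Adj v x) ^ k :=
      density_forall fun x => A x ∧ ¬ Γ.Adj v x
    calc η ^ k ≤ (density fun x => A x ∧ ¬ Γ.Adj v x) ^ k := by gcongr; exact hv.2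
      _ = _ := h1.symm
      _ ≤ _ := density_mono fun y hy => ⟨fun a => by simpa using hy a, by simpa using hv.1⟩
  rw [le_div_iff₀ (by positivity), mul_comm]
  refine hout.trans ?_
  have h1 := density_split F fun w => A (w 0)
  have h2 : ν * M ^ k ≤ M ^ (k + 1) + ω := by
    have h3 : (ν - ω) * M ^ k ≤ M * M ^ k := by gcongr
    have h4 : ω * M ^ k ≤ ω * 1 := by
      gcongr
      exact pow_le_one₀ hM0 hM1
    rw [pow_succ]
    linarith
  linarith

/-- Almost disjoint sparse sets of almost the extremal size become pairwise nearly complete after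
few vertices are removed from each. -/
theorem exists_nearly_complete (Γ : SimpleGraph V) {r k : ℕ} {ν ω γ ε η : ℝ} (hν0 : 0 ≤ ν)
    (hν : ∀ g : Fin k → V, (∀ a b, a ≠ b → g a ≠ g b ∧ ¬ Γ.Adj (g a) (g b)) →
      density (fun v => ∀ a, ¬ Γ.Adj v (g a)) ≤ ν) (hω : 0 ≤ ω) (hη : 0 < η) (hε : 0 ≤ ε)
    (hγ0 : 0 ≤ γ) (A : Fin r → V → Prop) (hA : ∀ i, ν - ω ≤ density (A i))
    (hγ : ∀ i, density (fun q : V × V => A i q.1 ∧ A i q.2 ∧ Γ.Adj q.1 q.2) ≤ γ)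
    (hAA : ∀ i j, i ≠ j → density (fun v => A i v ∧ A j v) ≤ ε) :
    ∃ T : Fin r → V → Prop,
      (∀ i, ν - ω - r * (ε + (ω + k ^ 2 * (γ + 1 / Fintype.card V) + k * γ) / η ^ k) ≤
        density (T i)) ∧
      ∀ i j, j ≠ i → ∀ v, T i v → density (fun x => T j x ∧ ¬ Γ.Adj v x) ≤ η := by
  let nn : Fin r → V → ℝ := fun j v => density fun x => A j x ∧ ¬ Γ.Adj v x
  refine ⟨fun i v => A i v ∧ ∀ j, j ≠ i → ¬ A j v ∧ nn j v < η, fun i => ?_, fun i j hj v hv => ?_⟩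
  · have h1 : density (A i) ≤ density (fun v => (A i v ∧ ∀ j, j ≠ i → ¬ A j v ∧ nn j v < η) ∨
        ∃ j ∈ (Finset.univ : Finset (Fin r)), j ≠ i ∧ ((A i v ∧ A j v) ∨
          (¬ A j v ∧ η ≤ nn j v))) := by
      refine density_mono fun v hv => ?_
      by_cases h : ∃ j, j ≠ i ∧ ((A i v ∧ A j v) ∨ (¬ A j v ∧ η ≤ nn j v))
      · obtain ⟨j, hj⟩ := h
        exact Or.inr ⟨j, Finset.mem_univ _, hj⟩
      · push Not at h
        exact Or.inl ⟨hv, fun j hj => ⟨(h j hj).1 hv, (h j hj).2 ((h j hj).1 hv)⟩⟩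
    have h2 := h1.trans (density_or_le _ _)
    have h3 : density (fun v => ∃ j ∈ (Finset.univ : Finset (Fin r)), j ≠ i ∧ ((A i v ∧ A j v) ∨
          (¬ A j v ∧ η ≤ nn j v))) ≤
        r * (ε + (ω + k ^ 2 * (γ + 1 / Fintype.card V) + k * γ) / η ^ k) := by
      refine (density_exists_le _ _).trans ?_
      calc _ ≤ ∑ j : Fin r, (ε + (ω + k ^ 2 * (γ + 1 / Fintype.card V) + k * γ) / η ^ k) := by
            refine Finset.sum_le_sum fun j _ => ?_
            by_cases hj : j = i
            · exact (density_false_le fun v hv => hv.1 hj).trans (by positivity)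
            · refine (density_mono fun v hv => hv.2).trans ((density_or_le _ _).trans ?_)
              exact add_le_add (hAA i j (Ne.symm hj))
                (density_outside_le Γ hν0 hν hω hη (A j) (hA j) (hγ j))
        _ = _ := by rw [Finset.sum_const, Finset.card_univ, Fintype.card_fin, nsmul_eq_mul]
    have := hA i
    linarith
  · exact (density_mono fun x hx => ⟨hx.1.1, hx.2⟩).trans (hv.2 j hj).2.le

end Cleaning

/-! ### Clique densities and the approximate partition -/

section Cliques

variable {V : Type*} [Fintype V] [Nonempty V]

theorem density_average_right {α β : Type*} [Fintype α] [Fintype β] (P : α × β → Prop) (θ : ℝ) :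
    θ * density (fun y => θ ≤ density fun x => P (x, y)) ≤ density P := by
  rw [density_prod_right]
  exact mul_density_le_average (fun _ => density_nonneg _) θ

/-- Every vertex misses some part of a blow-up completely, or has a neighbour in each part. -/
theorem one_le_sum_density_missing (Γ : SimpleGraph V) {j s : ℕ} (u : Fin j → Fin s → V) :
    1 ≤ (∑ i, density fun v => ∀ a, ¬ Γ.Adj v (u i a)) + density fun v => ∀ i, ∃ a, Γ.Adj v (u i a) := by
  have h1 : density (fun _ : V => True) = 1 := by simp [density]
  rw [← h1]
  refine le_trans (density_mono (Q := fun v => (∃ i ∈ (Finset.univ : Finset (Fin j)),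
    ∀ a, ¬ Γ.Adj v (u i a)) ∨ ∀ i, ∃ a, Γ.Adj v (u i a)) fun v _ => ?_)
    ((density_or_le _ _).trans (add_le_add_left (density_exists_le _ _) _))
  by_contra! h
  obtain ⟨h1, i, h2⟩ := h
  obtain ⟨a, ha⟩ := h1 i (Finset.mem_univ _)
  exact h2 a ha

theorem density_touching_le {V : Type*} [Fintype V] (Γ : SimpleGraph V) {j s : ℕ} (u : Fin j → Fin s → V) {θ : ℝ}
    (hθ : ∀ f : Fin j → Fin s, density (fun v => ∀ i, Γ.Adj v (u i (f i))) ≤ θ) :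
    density (fun v => ∀ i, ∃ a, Γ.Adj v (u i a)) ≤ s ^ j * θ := by
  calc _ ≤ density (fun v => ∃ f ∈ (Finset.univ : Finset (Fin j → Fin s)),
        ∀ i, Γ.Adj v (u i (f i))) := by
        refine density_mono fun v hv => ?_
        choose f hf using hv
        exact ⟨f, Finset.mem_univ _, hf⟩
    _ ≤ ∑ f : Fin j → Fin s, density fun v => ∀ i, Γ.Adj v (u i (f i)) := density_exists_le _ _
    _ ≤ ∑ _f : Fin j → Fin s, θ := Finset.sum_le_sum fun f _ => hθ f
    _ = _ := by simp

/-- One step of the clique count: if most `j`-cliques had few common neighbours, then so would all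
transversals of some blow-up with independent parts of size `k`; the vertices missing one of
these `j` parts would not exhaust the graph. -/
theorem le_density_clique_succ (Γ : SimpleGraph V) {j k : ℕ} {ν α θ c : ℝ}
    (hν : ∀ g : Fin k → V, (∀ a b, a ≠ b → g a ≠ g b ∧ ¬ Γ.Adj (g a) (g b)) →
      density (fun v => ∀ a, ¬ Γ.Adj v (g a)) ≤ ν) (hα : 0 ≤ α)
    (hαc : α ≤ density fun y : Fin j → V => IsCliqueTuple Γ y) (hθ : 0 < θ)
    (hθν : j * ν + k ^ j * θ < 1) (hc1 : c ≤ θ * (α / 2))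
    (hc2 : j * k ^ 2 * (c + 1 / Fintype.card V) < (α / 2) ^ (k ^ j)) :
    c ≤ density fun y : Fin (j + 1) → V => IsCliqueTuple Γ y := by
  by_contra! hlt
  let H : (Fin j → V) → Prop := fun y => IsCliqueTuple Γ y ∧
    ¬ θ ≤ density fun z => IsCliqueTuple Γ (Fin.cons z y : Fin (j + 1) → V)
  have hH : α / 2 ≤ density H := by
    have h1 := density_split (fun y : Fin j → V => IsCliqueTuple Γ y) fun y =>
      θ ≤ density fun z => IsCliqueTuple Γ (Fin.cons z y : Fin (j + 1) → V)
    have h2 := mul_density_le_average (f := fun y : Fin j → V =>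
      density fun z => IsCliqueTuple Γ (Fin.cons z y : Fin (j + 1) → V))
      (fun _ => density_nonneg _) θ
    rw [← density_cons_right fun y : Fin (j + 1) → V => IsCliqueTuple Γ y] at h2
    have h3 : density (fun y : Fin j → V => IsCliqueTuple Γ y ∧
        θ ≤ density fun z => IsCliqueTuple Γ (Fin.cons z y : Fin (j + 1) → V)) ≤
        density fun y : Fin j → V =>
          θ ≤ density fun z => IsCliqueTuple Γ (Fin.cons z y : Fin (j + 1) → V) :=
      density_mono fun y hy => hy.2
    have h4 : density (fun y : Fin j → V =>
          θ ≤ density fun z => IsCliqueTuple Γ (Fin.cons z y : Fin (j + 1) → V)) ≤ α / 2 :=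
      le_of_mul_le_mul_left (h2.trans (hlt.le.trans hc1)) hθ
    change α / 2 ≤ density fun y => _ ∧ ¬ _
    linarith
  obtain ⟨u, hu, hu'⟩ := exists_blowup_independent Γ H (fun y hy => hy.1) (by positivity) hH hlt.le
    hc2
  have h1 := one_le_sum_density_missing Γ u
  have h2 := density_touching_le Γ u (θ := θ) fun f => by
    have := (hu f).2
    push Not at this
    refine (density_mono fun v hv => ?_).trans this.le
    exact (isCliqueTuple_cons Γ _ _).2 ⟨(hu f).1, hv⟩
  have h3 : (∑ i, density fun v => ∀ a, ¬ Γ.Adj v (u i a)) ≤ j * ν := by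
    calc _ ≤ ∑ _i : Fin j, ν := Finset.sum_le_sum fun i _ => hν (u i) (hu' i)
      _ = _ := by simp
  linarith

/-- Edges inside the common neighbourhood of all but one member of an `r`-clique come from
`(r + 1)`-cliques. -/
theorem density_clique_edge_le (Γ : SimpleGraph V) {r : ℕ} (j : Fin r) :
    density (fun q : (V × V) × (Fin r → V) => IsCliqueTuple Γ q.2 ∧
      (∀ i, i ≠ j → Γ.Adj q.1.1 (q.2 i)) ∧ (∀ i, i ≠ j → Γ.Adj q.1.2 (q.2 i)) ∧
        Γ.Adj q.1.1 q.1.2) ≤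
    density fun y : Fin (r + 1) → V => IsCliqueTuple Γ y := by
  let E : (V × V) × (Fin r → V) → (V × V) × (Fin r → V) := fun q =>
    ((q.2 j, q.1.2), Function.update q.2 j q.1.1)
  have hE : Function.Involutive E := fun q => by simp [E]
  have h1 : density (fun q : (V × V) × (Fin r → V) =>
      IsCliqueTuple Γ (Fin.cons q.1.2 q.2 : Fin (r + 1) → V)) =
      density fun y : Fin (r + 1) → V => IsCliqueTuple Γ y := by
    rw [density_prod_right, density_cons_right]
    congr 1
    refine Finset.sum_congr rfl fun y _ => ?_
    rw [← density_equiv (Equiv.prodComm V V)]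
    exact density_fst fun x => IsCliqueTuple Γ (Fin.cons x y : Fin (r + 1) → V)
  rw [← h1]
  refine le_trans ?_ (density_equiv hE.toPerm fun q : (V × V) × (Fin r → V) =>
    IsCliqueTuple Γ (Fin.cons q.1.2 q.2 : Fin (r + 1) → V)).le
  refine density_mono fun q hq => ?_
  obtain ⟨h1, h2, h3, h4⟩ := hq
  change IsCliqueTuple Γ (Fin.cons q.1.2 (Function.update q.2 j q.1.1) : Fin (r + 1) → V)
  rw [isCliqueTuple_cons]
  refine ⟨fun i i' hi => ?_, fun i => ?_⟩
  · by_cases hij : i = j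
    · subst hij
      simpa [Function.update_of_ne hi.symm] using h2 i' hi.symm
    · by_cases hij' : i' = j
      · subst hij'
        simpa [Function.update_of_ne hij] using (h2 i hij).symm
      · simpa [hij, hij'] using h1 i i' hi
  · by_cases hij : i = j
    · subst hij
      simpa using h4.symm
    · simpa [hij] using h3 i hij

/-- In an independent set all of whose `k`-subsets have small common non-neighbourhood, not much
larger than that of the whole set, some vertex has few other non-neighbours. -/
theorem exists_few_nonneighbours (Γ : SimpleGraph V) {k s : ℕ} {ν ξ : ℝ} (hs : 0 < s)
    (hν : ∀ g : Fin k → V, (∀ a b, a ≠ b → g a ≠ g b ∧ ¬ Γ.Adj (g a) (g b)) →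
      density (fun v => ∀ a, ¬ Γ.Adj v (g a)) ≤ ν) (u : Fin s → V)
    (hu : ∀ a b, a ≠ b → u a ≠ u b ∧ ¬ Γ.Adj (u a) (u b)) (hξ0 : 0 ≤ ξ)
    (hξ : ν - ξ ≤ density fun v => ∀ a, ¬ Γ.Adj v (u a)) :
    ∃ a, density (fun v => ¬ Γ.Adj v (u a) ∧ ∃ b, Γ.Adj v (u b)) ≤ k / s + s ^ k * ξ := by
  classical
  have : Nonempty (Fin s) := ⟨⟨0, hs⟩⟩
  let many : V → Prop := fun v => (∃ b, Γ.Adj v (u b)) ∧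
    k ≤ (Finset.univ.filter fun a => ¬ Γ.Adj v (u a)).card
  have hmany : density many ≤ s ^ k * ξ := by
    calc density many ≤ density (fun v => ∃ g ∈ (Finset.univ : Finset (Fin k → Fin s)),
          Function.Injective g ∧ (∀ a, ¬ Γ.Adj v (u (g a))) ∧ ∃ b, Γ.Adj v (u b)) := by
          refine density_mono fun v hv => ?_
          obtain ⟨D, hD, hDc⟩ := Finset.exists_subset_card_eq hv.2
          have e : Fin k ≃ D := Fintype.equivOfCardEq (by simp [hDc])
          exact ⟨fun a => e a, Finset.mem_univ _, fun a b hab => e.injective (Subtype.ext hab),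
            fun a => (Finset.mem_filter.1 (hD (e a).2)).2, hv.1⟩
      _ ≤ ∑ g : Fin k → Fin s, density fun v => Function.Injective g ∧
          (∀ a, ¬ Γ.Adj v (u (g a))) ∧ ∃ b, Γ.Adj v (u b) := density_exists_le _ _
      _ ≤ ∑ _g : Fin k → Fin s, ξ := by
        refine Finset.sum_le_sum fun g _ => ?_
        by_cases hg : Function.Injective g
        · have h1 := hν (u ∘ g) fun a b hab => hu _ _ fun h => hab (hg h)
          have h2 := density_split (fun v => ∀ a, ¬ Γ.Adj v (u (g a))) fun v => ∃ b, Γ.Adj v (u b)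
          have h3 : density (fun v => ∀ a, ¬ Γ.Adj v (u a)) ≤
              density fun v => (∀ a, ¬ Γ.Adj v (u (g a))) ∧ ¬ ∃ b, Γ.Adj v (u b) :=
            density_mono fun v hv => ⟨fun a => hv _, fun ⟨b, hb⟩ => hv b hb⟩
          have h4 : density (fun v => Function.Injective g ∧
              (∀ a, ¬ Γ.Adj v (u (g a))) ∧ ∃ b, Γ.Adj v (u b)) ≤
              density fun v => (∀ a, ¬ Γ.Adj v (u (g a))) ∧ ∃ b, Γ.Adj v (u b) :=
            density_mono fun v hv => hv.2
          simp only [Function.comp] at h1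
          linarith
        · exact (density_false_le fun v hv => hg hv.1).trans hξ0
      _ = _ := by simp
  let P : Fin s × V → Prop := fun q => ¬ Γ.Adj q.2 (u q.1) ∧ ∃ b, Γ.Adj q.2 (u b)
  have hP : density P ≤ k / s + s ^ k * ξ := by
    calc density P ≤ density (fun q : Fin s × V => (P q ∧ ¬ many q.2) ∨ many q.2) :=
          density_mono fun q hq => by by_cases h : many q.2 <;> tauto
      _ ≤ density (fun q : Fin s × V => P q ∧ ¬ many q.2) +
          density fun q : Fin s × V => many q.2 := density_or_le _ _
      _ ≤ _ := by
        refine add_le_add ?_ (le_trans ?_ hmany)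
        · rw [density_prod_right]
          refine average_le fun v => ?_
          unfold density
          rw [Fintype.card_fin]
          gcongr
          by_cases h : many v
          · simp [h]
          · by_cases hb : ∃ b, Γ.Adj v (u b)
            · have : ¬ k ≤ (Finset.univ.filter fun a => ¬ Γ.Adj v (u a)).card := fun h' => h ⟨hb, h'⟩
              refine (Finset.card_le_card ?_).trans (not_le.1 this).le
              intro a ha
              simp only [Finset.mem_filter] at ha ⊢
              exact ⟨ha.1, ha.2.1.1⟩
            · simp only [P, hb]
              simp
        · rw [density_prod]
          exact average_le fun a => le_rfl
  by_contra! h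
  have h1 := Finset.sum_lt_sum_of_nonempty (s := (Finset.univ : Finset (Fin s)))
    Finset.univ_nonempty fun a _ => h a
  rw [density_prod, div_le_iff₀ (by rw [Fintype.card_fin]; exact_mod_cast hs), Fintype.card_fin] at hP
  rw [Finset.sum_const, Finset.card_univ, Fintype.card_fin, nsmul_eq_mul] at h1
  linarith

/-- If there are many `r`-cliques but very few `(r + 1)`-cliques, then the graph contains `r`
sparse, almost disjoint sets of almost the extremal size: the common neighbourhoods of the
`(r - 1)`-subsets of a suitable `r`-clique. -/
theorem exists_sparse_sets (Γ : SimpleGraph V) {r k s : ℕ} {ν κ c ε γ : ℝ}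
    (hν : ∀ g : Fin k → V, (∀ a b, a ≠ b → g a ≠ g b ∧ ¬ Γ.Adj (g a) (g b)) →
      density (fun v => ∀ a, ¬ Γ.Adj v (g a)) ≤ ν) (hrν : r * ν ≤ 1) (hκ : 0 ≤ κ)
    (hκr : κ ≤ density fun y : Fin r → V => IsCliqueTuple Γ y)
    (hc : density (fun y : Fin (r + 1) → V => IsCliqueTuple Γ y) ≤ c) (hε : 0 < ε) (hγ : 0 < γ)
    (hcκ : c / ε + r * (c / γ) ≤ κ / 2)
    (hcs : r * s ^ 2 * (c + 1 / Fintype.card V) < (κ / 2) ^ (s ^ r)) (hks : k ≤ s) (hs : 0 < s)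
    (hsε : s ^ (k + 1 + r) * ε ≤ 1) :
    ∃ A : Fin r → V → Prop, (∀ i, ν - r * ((k + 1) / s) ≤ density (A i)) ∧
      (∀ i, density (fun q : V × V => A i q.1 ∧ A i q.2 ∧ Γ.Adj q.1 q.2) ≤ γ) ∧
      ∀ i j, i ≠ j → density (fun v => A i v ∧ A j v) ≤ ε := by
  let bad1 : (Fin r → V) → Prop := fun y =>
    ε ≤ density fun z => IsCliqueTuple Γ (Fin.cons z y : Fin (r + 1) → V)
  let Q : Fin r → (V × V) × (Fin r → V) → Prop := fun j q => IsCliqueTuple Γ q.2 ∧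
      (∀ i, i ≠ j → Γ.Adj q.1.1 (q.2 i)) ∧ (∀ i, i ≠ j → Γ.Adj q.1.2 (q.2 i)) ∧
        Γ.Adj q.1.1 q.1.2
  let bad2 : Fin r → (Fin r → V) → Prop := fun j y => γ ≤ density fun p : V × V => Q j (p, y)
  let H : (Fin r → V) → Prop := fun y => IsCliqueTuple Γ y ∧
    ¬ (bad1 y ∨ ∃ j ∈ (Finset.univ : Finset (Fin r)), bad2 j y)
  have hb1 : density bad1 ≤ c / ε := by
    rw [le_div_iff₀ hε, mul_comm]
    refine (mul_density_le_average (fun _ => density_nonneg _) ε).trans ?_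
    rw [← density_cons_right fun y : Fin (r + 1) → V => IsCliqueTuple Γ y]
    exact hc
  have hb2 : ∀ j, density (bad2 j) ≤ c / γ := fun j => by
    rw [le_div_iff₀ hγ, mul_comm]
    exact (density_average_right (Q j) γ).trans ((density_clique_edge_le Γ j).trans hc)
  have hH : κ / 2 ≤ density H := by
    have h1 := density_split (fun y : Fin r → V => IsCliqueTuple Γ y) fun y =>
      bad1 y ∨ ∃ j ∈ (Finset.univ : Finset (Fin r)), bad2 j y
    have h2 : density (fun y : Fin r → V => IsCliqueTuple Γ y ∧
        (bad1 y ∨ ∃ j ∈ (Finset.univ : Finset (Fin r)), bad2 j y)) ≤ c / ε + r * (c / γ) := by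
      refine (density_mono fun y hy => hy.2).trans ((density_or_le _ _).trans ?_)
      refine add_le_add hb1 ((density_exists_le _ _).trans ?_)
      calc _ ≤ ∑ _j : Fin r, c / γ := Finset.sum_le_sum fun j _ => hb2 j
        _ = _ := by simp
    change κ / 2 ≤ density fun y => _ ∧ ¬ _
    linarith
  obtain ⟨u, hu, hu'⟩ := exists_blowup_independent Γ H (fun y hy => hy.1) (by positivity) hH hc hcs
  have hs0 : (0 : ℝ) < s := by exact_mod_cast hs
  have hcommon : ∀ f : Fin r → Fin s, density (fun v => ∀ i, Γ.Adj v (u i (f i))) ≤ ε := fun f => by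
    have h1 : ¬ bad1 _ := fun h => (hu f).2 (Or.inl h)
    refine (density_mono fun v hv => ?_).trans (not_le.1 h1).le
    exact (isCliqueTuple_cons Γ _ _).2 ⟨(hu f).1, hv⟩
  set ξ : ℝ := s ^ r * ε with hξ
  have hmiss : ∀ i, density (fun v => ∀ a, ¬ Γ.Adj v (u i a)) ≤ ν := fun i => by
    refine (density_mono fun v hv a => ?_).trans (hν (fun b => u i (Fin.castLE hks b))
      fun a b hab => hu' i _ _ fun h => hab (Fin.castLE_injective hks h))
    exact hv _
  have hX := density_touching_le Γ u hcommon
  have hcover := one_le_sum_density_missing Γ u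
  have hlow : ∀ i, ν - ξ ≤ density fun v => ∀ a, ¬ Γ.Adj v (u i a) := fun i => by
    have h1 : (∑ i', density fun v => ∀ a, ¬ Γ.Adj v (u i' a)) - ν ≤
        (density fun v => ∀ a, ¬ Γ.Adj v (u i a)) + (r * ν - ν) - ν := by
      have h2 : (∑ i', density fun v => ∀ a, ¬ Γ.Adj v (u i' a)) =
        (density fun v => ∀ a, ¬ Γ.Adj v (u i a)) +
          ∑ i' ∈ Finset.univ.erase i, density fun v => ∀ a, ¬ Γ.Adj v (u i' a) :=
        (Finset.add_sum_erase _ _ (Finset.mem_univ i)).symm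
      have h3 : ∑ i' ∈ Finset.univ.erase i, density (fun v => ∀ a, ¬ Γ.Adj v (u i' a)) ≤
          ∑ i' ∈ Finset.univ.erase i, ν := Finset.sum_le_sum fun i' _ => hmiss i'
      have h4 : ν + ∑ i' ∈ Finset.univ.erase i, ν = r * ν := by
        rw [Finset.add_sum_erase _ (fun _ => ν) (Finset.mem_univ i)]
        simp
      linarith
    linarith
  have hpick : ∀ i, ∃ a, density (fun v => ¬ Γ.Adj v (u i a) ∧ ∃ b, Γ.Adj v (u i b)) ≤
      (k + 1) / s := fun i => by
    obtain ⟨a, ha⟩ := exists_few_nonneighbours Γ hs hν (u i) (hu' i) (by positivity) (hlow i)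
    refine ⟨a, ha.trans ?_⟩
    rw [add_div]
    gcongr
    rw [le_div_iff₀ hs0, hξ]
    calc (s : ℝ) ^ k * (s ^ r * ε) * s = s ^ (k + 1 + r) * ε := by ring
      _ ≤ 1 := hsε
  choose f hf using hpick
  refine ⟨fun j v => ∀ i, i ≠ j → Γ.Adj v (u i (f i)), fun j => ?_, fun j => ?_,
    fun i j hij => ?_⟩
  · have h1 : density (fun _ : V => True) = 1 := by simp [density]
    have h2 : density (fun _ : V => True) ≤ density (fun v => (∀ i, i ≠ j → Γ.Adj v (u i (f i))) ∨
        ∃ i ∈ Finset.univ.erase j, (∀ a, ¬ Γ.Adj v (u i a)) ∨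
          (¬ Γ.Adj v (u i (f i)) ∧ ∃ b, Γ.Adj v (u i b))) := by
      refine density_mono fun v _ => ?_
      by_cases h : ∀ i, i ≠ j → Γ.Adj v (u i (f i))
      · exact Or.inl h
      · push Not at h
        obtain ⟨i, hij, hi⟩ := h
        refine Or.inr ⟨i, Finset.mem_erase.2 ⟨hij, Finset.mem_univ _⟩, ?_⟩
        by_cases hb : ∃ b, Γ.Adj v (u i b)
        · exact Or.inr ⟨hi, hb⟩
        · push Not at hb
          exact Or.inl hb
    have h3 := h2.trans ((density_or_le _ _).trans (add_le_add_right (density_exists_le _ _) _))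
    have h4 : ∑ i ∈ Finset.univ.erase j, density (fun v => (∀ a, ¬ Γ.Adj v (u i a)) ∨
          (¬ Γ.Adj v (u i (f i)) ∧ ∃ b, Γ.Adj v (u i b))) ≤
        ∑ i ∈ Finset.univ.erase j, (ν + (k + 1) / (s : ℝ)) :=
      Finset.sum_le_sum fun i _ => (density_or_le _ _).trans (add_le_add (hmiss i) (hf i))
    have h5 : (ν + (k + 1) / (s : ℝ)) + ∑ i ∈ Finset.univ.erase j, (ν + (k + 1) / (s : ℝ)) =
        r * (ν + (k + 1) / s) := by
      rw [Finset.add_sum_erase _ (fun _ => ν + (k + 1) / (s : ℝ)) (Finset.mem_univ j)]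
      rw [Finset.sum_const, Finset.card_univ, Fintype.card_fin, nsmul_eq_mul]
    have h6 : 0 ≤ (k + 1 : ℝ) / s := by positivity
    linarith
  · have h1 : ¬ bad2 j _ := fun h => (hu f).2 (Or.inr ⟨j, Finset.mem_univ _, h⟩)
    refine (density_mono fun q hq => ?_).trans (not_le.1 h1).le
    exact ⟨(hu f).1, hq⟩
  · refine (density_mono fun v hv i' => ?_).trans (hcommon f)
    by_cases h : i' = i
    · subst h
      exact hv.2 _ hij
    · exact hv.1 _ h

end Cliques

/-! ### Ramsey numbers: finiteness, lower bounds and embeddings -/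

open Classical in
/-- Ramsey's theorem for two colours, with the bound `2 ^ (a + b)`. -/
theorem exists_clique_or_compl_clique {V : Type*} (Γ : SimpleGraph V) (m : ℕ) :
    ∀ (a b : ℕ), a + b ≤ m → ∀ s : Finset V, 2 ^ m ≤ s.card →
      (∃ t ⊆ s, Γ.IsNClique a t) ∨ ∃ t ⊆ s, Γᶜ.IsNClique b t := by
  induction m with
  | zero =>
    intro a b hab s _
    obtain rfl : a = 0 := by omega
    exact Or.inl ⟨∅, by simp, by simp [SimpleGraph.isNClique_iff]⟩
  | succ m ih =>
    intro a b hab s hs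
    rcases a with _ | a
    · exact Or.inl ⟨∅, by simp, by simp [SimpleGraph.isNClique_iff]⟩
    rcases b with _ | b
    · exact Or.inr ⟨∅, by simp, by simp [SimpleGraph.isNClique_iff]⟩
    have hpos : 0 < 2 ^ m := by positivity
    obtain ⟨v, hv⟩ : s.Nonempty := Finset.card_pos.1 (by rw [pow_succ] at hs; omega)
    have h1 := Finset.card_filter_add_card_filter_not (s := s.erase v) (fun x => Γ.Adj v x)
    rw [Finset.card_erase_of_mem hv] at h1
    rw [pow_succ] at hs
    have hsub : ∀ (P : V → Prop) [DecidablePred P], (s.erase v).filter P ⊆ s := fun P _ =>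
      (Finset.filter_subset _ _).trans (Finset.erase_subset _ _)
    by_cases h : 2 ^ m ≤ ((s.erase v).filter fun x => Γ.Adj v x).card
    · rcases ih a (b + 1) (by omega) _ h with ⟨t, ht, hc⟩ | ⟨t, ht, hc⟩
      · refine Or.inl ⟨insert v t, Finset.insert_subset hv (ht.trans (hsub _)), hc.insert ?_⟩
        exact fun x hx => (Finset.mem_filter.1 (ht hx)).2
      · exact Or.inr ⟨t, ht.trans (hsub _), hc⟩
    · rcases ih (a + 1) b (by omega) ((s.erase v).filter fun x => ¬ Γ.Adj v x) (by omega) with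
        ⟨t, ht, hc⟩ | ⟨t, ht, hc⟩
      · exact Or.inl ⟨t, ht.trans (hsub _), hc⟩
      · refine Or.inr ⟨insert v t, Finset.insert_subset hv (ht.trans (hsub _)), hc.insert ?_⟩
        intro x hx
        have hx := Finset.mem_filter.1 (ht hx)
        rw [SimpleGraph.compl_adj]
        exact ⟨fun h => (Finset.mem_erase.1 hx.1).1 h.symm, hx.2⟩

theorem isContained_of_isNClique {V W : Type*} [Fintype W] {G : SimpleGraph W} {Γ : SimpleGraph V}
    {t : Finset V} (ht : Γ.IsNClique (Fintype.card W) t) : G.IsContained Γ := by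
  have e : W ≃ t := Fintype.equivOfCardEq (by simp [ht.card_eq])
  refine ⟨⟨⟨fun w => e w, fun {w w'} h => ?_⟩, fun w w' h => e.injective (Subtype.ext h)⟩⟩
  exact ht.isClique (e w).2 (e w').2 fun h' => h.ne (e.injective (Subtype.ext h'))

theorem exists_ramsey {W W' : Type*} [Fintype W] [Fintype W'] (G : SimpleGraph W)
    (H : SimpleGraph W') :
    ∃ N, ∀ Γ : SimpleGraph (Fin N), G.IsContained Γ ∨ H.IsContained Γᶜ := by
  refine ⟨2 ^ (Fintype.card W + Fintype.card W'), fun Γ => ?_⟩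
  rcases exists_clique_or_compl_clique Γ _ (Fintype.card W) (Fintype.card W') le_rfl Finset.univ
    (by simp) with ⟨t, -, ht⟩ | ⟨t, -, ht⟩
  · exact Or.inl (isContained_of_isNClique ht)
  · exact Or.inr (isContained_of_isNClique ht)

theorem isContained_compl_comap {U V W : Type*} {H : SimpleGraph W} (Γ : SimpleGraph V)
    (e : U ↪ V) (h : H.IsContained (Γ.comap e)ᶜ) : H.IsContained Γᶜ := by
  refine h.trans ⟨⟨⟨e, fun {a b} hab => ?_⟩, e.injective⟩⟩
  rw [SimpleGraph.compl_adj] at hab ⊢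
  exact ⟨fun h => hab.1 (e.injective h), hab.2⟩

theorem lt_ramseyNumber {V W W' : Type*} [Fintype V] [Fintype W] [Fintype W'] {G : SimpleGraph W}
    {H : SimpleGraph W'} (Γ : SimpleGraph V) (hG : ¬ G.IsContained Γ) (hH : ¬ H.IsContained Γᶜ) :
    Fintype.card V < ramseyNumber G H := by
  have hne : {N : ℕ | ∀ Γ : SimpleGraph (Fin N), G.IsContained Γ ∨ H.IsContained Γᶜ}.Nonempty :=
    exists_ramsey G H
  have hmem := Nat.sInf_mem hne
  by_contra! hle
  obtain ⟨e⟩ : Nonempty (Fin (ramseyNumber G H) ↪ V) :=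
    Function.Embedding.nonempty_of_card_le (by simpa using hle)
  rcases hmem (Γ.comap e) with h | h
  · exact hG (h.trans ⟨⟨⟨e, fun hab => hab⟩, e.injective⟩⟩)
  · exact hH (isContained_compl_comap Γ e h)

theorem isContained_of_hasParts {V : Type*} {Γ : SimpleGraph V} {p : ℕ} {a : ℕ → ℕ}
    (h : HasParts Γ p a) : (completePartite p a).IsContained Γ := by
  obtain ⟨B, hB, hadj⟩ := h
  have hemb : ∀ i : Fin p, ∃ e : Fin (a (i.val + 1)) → V, Function.Injective e ∧ ∀ x, e x ∈ B i := by
    intro i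
    obtain ⟨D, hD, hDc⟩ := Finset.exists_subset_card_eq (hB i)
    have e : Fin (a (i.val + 1)) ≃ D := Fintype.equivOfCardEq (by simp [hDc])
    exact ⟨fun x => e x, fun x y hxy => e.injective (Subtype.ext hxy), fun x => hD (e x).2⟩
  choose e he heB using hemb
  have hadj' : ∀ i j, i ≠ j → ∀ x y, Γ.Adj (e i x) (e j y) := by
    intro i j hij x y
    rcases lt_or_gt_of_ne hij with h | h
    · exact hadj i j h _ (heB i x) _ (heB j y)
    · exact (hadj j i h _ (heB j y) _ (heB i x)).symm
  refine ⟨⟨⟨fun x => e x.1 x.2, fun {x y} hxy => hadj' _ _ hxy _ _⟩, ?_⟩⟩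
  rintro ⟨i, x⟩ ⟨j, y⟩ hxy
  change e i x = e j y at hxy
  by_cases hij : i = j
  · subst hij
    rw [he i hxy]
  · exact absurd (hadj' i j hij x y) (by rw [hxy]; exact Γ.irrefl)

open Classical in
theorem complBookFree_of_not_isContained {V : Type*} [Fintype V] {Γ : SimpleGraph V} {k n : ℕ}
    (hkn : k ≤ n) (h : ¬ (bookGraph k n).IsContained Γᶜ) : ComplBookFree Γ k n := by
  intro g hg S hS
  by_contra! hcard
  apply h
  have hgc : (Finset.univ.image g).card ≤ k := Finset.card_image_le.trans (by simp)
  obtain ⟨D, hD, hDc⟩ := Finset.exists_subset_card_eq (s := S \ Finset.univ.image g) (n := n - k) (by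
    have := Finset.le_card_sdiff (Finset.univ.image g) S
    omega)
  have e : Fin (n - k) ≃ D := Fintype.equivOfCardEq (by simp [hDc])
  let φ : Fin n → V := fun v => if hv : v.val < k then g ⟨v, hv⟩ else
    e ⟨v.val - k, by omega⟩
  have hφ1 : ∀ v (hv : v.val < k), φ v = g ⟨v, hv⟩ := fun v hv => dif_pos hv
  have hφ2 : ∀ v (hv : ¬ v.val < k), φ v = e ⟨v.val - k, by omega⟩ := fun v hv => dif_neg hv
  have hgD : ∀ a x, g a ≠ (e x : V) := by
    intro a x hax
    have := (Finset.mem_sdiff.1 (hD (e x).2)).2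
    exact this (Finset.mem_image.2 ⟨a, Finset.mem_univ _, hax⟩)
  have hinj : Function.Injective φ := by
    intro v w hvw
    by_cases hv : v.val < k <;> by_cases hw : w.val < k
    · rw [hφ1 v hv, hφ1 w hw] at hvw
      by_contra hne
      exact (hg ⟨v, hv⟩ ⟨w, hw⟩ fun h => hne (Fin.ext (by simpa using h))).1 hvw
    · rw [hφ1 v hv, hφ2 w hw] at hvw
      exact absurd hvw (hgD _ _)
    · rw [hφ2 v hv, hφ1 w hw] at hvw
      exact absurd hvw.symm (hgD _ _)
    · rw [hφ2 v hv, hφ2 w hw] at hvw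
      have := e.injective (Subtype.ext hvw)
      simp only [Fin.mk.injEq] at this
      exact Fin.ext (by omega)
  have hspine : ∀ v w, v ≠ w → w.val < k → ¬ Γ.Adj (φ v) (φ w) := by
    intro v w hvw hw
    rw [hφ1 w hw]
    by_cases hv : v.val < k
    · rw [hφ1 v hv]
      exact (hg _ _ fun h => hvw (Fin.ext (by simpa using h))).2
    · rw [hφ2 v hv]
      exact hS _ (Finset.mem_sdiff.1 (hD (e _).2)).1 _
  refine ⟨⟨⟨φ, fun {v w} hvw => ?_⟩, hinj⟩⟩
  rw [SimpleGraph.compl_adj]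
  refine ⟨fun h => hvw.1 (hinj h), ?_⟩
  rcases hvw.2 with h | h
  · exact fun hadj => hspine w v hvw.1.symm h hadj.symm
  · exact hspine v w hvw.1 h

/-- The lower bound from disjoint cliques of size `n - 1` in the complement. -/
theorem mul_pred_lt_ramseyNumber {p k n : ℕ} {a : ℕ → ℕ} (hp : 1 ≤ p) (hk : 1 ≤ k) (hn : 1 ≤ n)
    (ha : ∀ i, 1 ≤ i → i ≤ p → 1 ≤ a i) :
    (p - 1) * (n - 1) < ramseyNumber (completePartite p a) (bookGraph k n) := by
  let Γ : SimpleGraph (Fin (p - 1) × Fin (n - 1)) :=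
    { Adj := fun x y => x.1 ≠ y.1
      symm := ⟨fun _ _ h => h.symm⟩
      loopless := ⟨fun _ h => h rfl⟩ }
  have h := lt_ramseyNumber (G := completePartite p a) (H := bookGraph k n) Γ ?_ ?_
  · simpa using h
  · rintro ⟨f⟩
    let g : Fin p → Fin (p - 1) := fun i =>
      (f ⟨i, ⟨0, ha _ (by omega) (by omega)⟩⟩ : Fin (p - 1) × Fin (n - 1)).1
    obtain ⟨i, j, hij, hg⟩ := Fintype.exists_ne_map_eq_of_card_lt g (by simp; omega)
    have h1 : Γ.Adj (f ⟨i, ⟨0, ha _ (by omega) (by omega)⟩⟩)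
        (f ⟨j, ⟨0, ha _ (by omega) (by omega)⟩⟩) := f.toHom.map_rel hij
    exact h1 hg
  · rintro ⟨f⟩
    have h0 : ∀ v, (f v).1 = (f ⟨0, by omega⟩).1 := by
      intro v
      by_cases hv : v = ⟨0, by omega⟩
      · rw [hv]
      · have h1 : Γᶜ.Adj (f v) (f ⟨0, by omega⟩) := f.toHom.map_rel ⟨hv, Or.inr hk⟩
        by_contra hne
        exact ((SimpleGraph.compl_adj _ _ _).1 h1).2 hne
    have h1 : Function.Injective fun v => (f v).2 := fun v w hvw =>
      f.injective (Prod.ext ((h0 v).trans (h0 w).symm) hvw)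
    have := Fintype.card_le_of_injective _ h1
    simp at this
    omega

/-- Part sizes of the extremal graph for `a 2 ≥ 2`. -/
def extremalPartSize (q a n : ℕ) (i : Fin (q + 2)) : ℕ :=
  if i = 0 then a - 1 else if i = Fin.last (q + 1) then n else n - 1

/-- The complete multipartite graph with parts of sizes `a - 1`, `n - 1` (`q` times) and `n`, plus
a maximum matching (the pairs `{2x, 2x + 1}`) inside the part of size `n`. -/
def extremalGraph (q a n : ℕ) :
    SimpleGraph (Σ i : Fin (q + 2), Fin (extremalPartSize q a n i)) where
  Adj x y := x.1 ≠ y.1 ∨ (x.1 = Fin.last (q + 1) ∧ x ≠ y ∧ x.2.val / 2 = y.2.val / 2)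
  symm := ⟨fun x y h => by
    rcases h with h | ⟨h1, h2, h3⟩
    · exact Or.inl h.symm
    · by_cases h : y.1 = x.1
      · exact Or.inr ⟨h.trans h1, h2.symm, h3.symm⟩
      · exact Or.inl h⟩
  loopless := ⟨fun _ h => h.elim (fun h => h rfl) fun h => h.2.1 rfl⟩

theorem card_extremalGraph (q a n : ℕ) (ha : 1 ≤ a) (hn : 1 ≤ n) :
    Fintype.card (Σ i : Fin (q + 2), Fin (extremalPartSize q a n i)) =
      (q + 1) * (n - 1) + a := by
  rw [Fintype.card_sigma]
  simp only [Fintype.card_fin]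
  rw [Fin.sum_univ_succ, Fin.sum_univ_castSucc]
  have h1 : ∀ i : Fin q, extremalPartSize q a n i.castSucc.succ = n - 1 := by
    intro i
    have : i.castSucc.succ ≠ Fin.last (q + 1) := by
      intro h
      have := congrArg Fin.val h
      simp at this
      omega
    simp [extremalPartSize, this]
  have h2 : extremalPartSize q a n (Fin.last q).succ = n := by
    simp [extremalPartSize, Fin.ext_iff]
  have h3 : extremalPartSize q a n 0 = a - 1 := by simp [extremalPartSize]
  simp_rw [h1, h2, h3]
  simp
  obtain ⟨n, rfl⟩ : ∃ m, n = m + 1 := ⟨n - 1, by omega⟩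
  simp
  have : (q + 1) * n = q * n + n := by ring
  omega

/-- Each part of the extremal graph but the last meets only one part of an embedded complete
multipartite graph. So two of the latter's parts `P`, `Q` lie in the first and last parts, and
what they have in the last part is a complete bipartite graph on at least three vertices. -/
theorem not_isContained_extremalGraph {q n : ℕ} {a : ℕ → ℕ} (ha1 : 1 ≤ a 1)
    (hle : ∀ i, 1 ≤ i → i ≤ q + 2 → a 1 ≤ a i) (h2 : ∀ i, 2 ≤ i → i ≤ q + 2 → 2 ≤ a i) :
    ¬ (completePartite (q + 2) a).IsContained (extremalGraph q (a 1) n) := by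
  classical
  rintro ⟨f⟩
  have hfadj : ∀ x y, x.1 ≠ y.1 → (extremalGraph q (a 1) n).Adj (f x) (f y) := fun x y h =>
    f.toHom.map_rel h
  have hinj : Function.Injective f := f.injective
  have hsame : ∀ x y, (f x).1 = (f y).1 → (f x).1 ≠ Fin.last (q + 1) → x.1 = y.1 := by
    intro x y hxy hl
    by_contra hne
    rcases hfadj x y hne with h | h
    · exact h hxy
    · exact hl h.1
  let π : Fin (q + 2) → Fin (q + 2) := fun j =>
    if h : ∃ x, (f x).1 = j then h.choose.1 else 0
  have hπ : ∀ x, (f x).1 ≠ Fin.last (q + 1) → π (f x).1 = x.1 := by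
    intro x hx
    have h : ∃ y, (f y).1 = (f x).1 := ⟨x, rfl⟩
    simp only [π, dif_pos h]
    exact hsame _ _ h.choose_spec (by rw [h.choose_spec]; exact hx)
  let mid : Finset (Fin (q + 2)) := (Finset.univ.erase 0).erase (Fin.last (q + 1))
  have hmid : mid.card = q := by
    rw [Finset.card_erase_of_mem, Finset.card_erase_of_mem (Finset.mem_univ _)]
    · simp
    · simp [Fin.ext_iff]
  have hfree : 1 < (Finset.univ \ mid.image π).card := by
    have h1 := Finset.le_card_sdiff (mid.image π) Finset.univ
    have h2 : (mid.image π).card ≤ mid.card := Finset.card_image_le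
    rw [Finset.card_univ, Fintype.card_fin] at h1
    omega
  obtain ⟨P, hP, Q, hQ, hPQ⟩ := Finset.one_lt_card.1 hfree
  have hends : ∀ x, x.1 = P ∨ x.1 = Q → (f x).1 = 0 ∨ (f x).1 = Fin.last (q + 1) := by
    intro x hx
    by_contra! h
    have hm : x.1 ∈ mid.image π := Finset.mem_image.2 ⟨(f x).1, by simp [mid, h], hπ x h.2⟩
    rcases hx with hx | hx
    · rw [hx] at hm
      exact (Finset.mem_sdiff.1 hP).2 hm
    · rw [hx] at hm
      exact (Finset.mem_sdiff.1 hQ).2 hm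
  have hzero : ∀ S : Finset (Σ i : Fin (q + 2), Fin (a (i.val + 1))),
      (∀ x ∈ S, (f x).1 = 0) → S.card ≤ a 1 - 1 := by
    intro S hS
    have h1 : S.card ≤ (Finset.range (a 1 - 1)).card := by
      refine Finset.card_le_card_of_injOn (fun x => (f x).2.val) (fun x hx => ?_)
        fun x hx y hy hxy => ?_
      · have h2 : (f x).2.val < extremalPartSize q (a 1) n 0 :=
          (f x).2.2.trans_eq (congrArg _ (hS x hx))
        simpa [extremalPartSize] using h2
      · apply hinj
        have h1 := (hS x hx).trans (hS y hy).symm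
        refine Sigma.ext h1 ?_
        rw [Fin.heq_ext_iff (by rw [h1])]
        exact hxy
    simpa using h1
  have hpart : ∀ R : Fin (q + 2), R = P ∨ R = Q → ∃ x, x.1 = R ∧ (f x).1 = Fin.last (q + 1) := by
    intro R hR
    by_contra! h
    have h1 := hzero (Finset.univ.image fun y : Fin (a (R.val + 1)) => ⟨R, y⟩) (by
      intro x hx
      obtain ⟨y, -, rfl⟩ := Finset.mem_image.1 hx
      exact (hends _ hR).resolve_right (h _ rfl))
    rw [Finset.card_image_of_injective _ sigma_mk_injective] at h1
    have := hle (R.val + 1) (by omega) (by omega)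
    simp at h1
    omega
  obtain ⟨x, hxP, hx⟩ := hpart P (Or.inl rfl)
  obtain ⟨y, hyQ, hy⟩ := hpart Q (Or.inr rfl)
  have hhalf : ∀ z z', z.1 ≠ z'.1 → (f z).1 = Fin.last (q + 1) → (f z').1 = Fin.last (q + 1) →
      (f z).2.val / 2 = (f z').2.val / 2 := by
    intro z z' hz h1 h2
    rcases hfadj z z' hz with h | h
    · exact absurd (h1.trans h2.symm) h
    · exact h.2.2
  have hxy : (f x).2.val / 2 = (f y).2.val / 2 := hhalf x y (by rw [hxP, hyQ]; exact hPQ) hx hy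
  let S : Finset (Σ i : Fin (q + 2), Fin (a (i.val + 1))) :=
    Finset.univ.filter fun z => z.1 = P ∨ z.1 = Q
  have hS : S.card = a (P.val + 1) + a (Q.val + 1) := by
    have : S = (Finset.univ.image fun y : Fin (a (P.val + 1)) =>
        (⟨P, y⟩ : Σ i : Fin (q + 2), Fin (a (i.val + 1)))) ∪
        Finset.univ.image fun y : Fin (a (Q.val + 1)) => ⟨Q, y⟩ := by
      ext ⟨i, z⟩
      simp only [S, Finset.mem_filter, Finset.mem_univ, true_and, Finset.mem_union,
        Finset.mem_image]
      constructor
      · rintro (rfl | rfl)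
        · exact Or.inl ⟨z, rfl⟩
        · exact Or.inr ⟨z, rfl⟩
      · rintro (⟨w, hw⟩ | ⟨w, hw⟩)
        · exact Or.inl (congrArg Sigma.fst hw).symm
        · exact Or.inr (congrArg Sigma.fst hw).symm
    rw [this, Finset.card_union_of_disjoint, Finset.card_image_of_injective _ sigma_mk_injective,
      Finset.card_image_of_injective _ sigma_mk_injective]
    · simp
    · rw [Finset.disjoint_left]
      rintro z hz hz'
      obtain ⟨w, -, rfl⟩ := Finset.mem_image.1 hz
      obtain ⟨w', -, hw'⟩ := Finset.mem_image.1 hz'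
      exact hPQ (congrArg Sigma.fst hw').symm
  have h3 := Finset.card_filter_add_card_filter_not (s := S) fun z => (f z).1 = 0
  have h4 := hzero (S.filter fun z => (f z).1 = 0) fun z hz => (Finset.mem_filter.1 hz).2
  have h5 : (S.filter fun z => ¬ (f z).1 = 0).card ≤ 2 := by
    have h6 : (S.filter fun z => ¬ (f z).1 = 0).card ≤
        ({2 * ((f y).2.val / 2), 2 * ((f y).2.val / 2) + 1} : Finset ℕ).card := by
      have hlast : ∀ z ∈ S.filter fun z => ¬ (f z).1 = 0, (f z).1 = Fin.last (q + 1) := by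
        intro z hz
        rw [Finset.mem_filter] at hz
        exact (hends z (Finset.mem_filter.1 hz.1).2).resolve_left hz.2
      refine Finset.card_le_card_of_injOn (fun z => (f z).2.val) (fun z hz => ?_)
        fun z hz z' hz' hzz => ?_
      · have hzl := hlast z hz
        have hzPQ := (Finset.mem_filter.1 (Finset.mem_filter.1 hz).1).2
        have : (f z).2.val / 2 = (f y).2.val / 2 := by
          rcases hzPQ with h | h
          · exact hhalf z y (by rw [h, hyQ]; exact hPQ) hzl hy
          · rw [← hxy]
            exact hhalf z x (by rw [h, hxP]; exact hPQ.symm) hzl hx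
        simp only [Finset.coe_insert, Finset.coe_singleton, Set.mem_insert_iff,
          Set.mem_singleton_iff]
        omega
      · apply hinj
        have h1 := (hlast z hz).trans (hlast z' hz').symm
        refine Sigma.ext h1 ?_
        rw [Fin.heq_ext_iff (by rw [h1])]
        exact hzz
    exact h6.trans Finset.card_le_two
  have h7 := hle (P.val + 1) (by omega) (by omega)
  have h8 := hle (Q.val + 1) (by omega) (by omega)
  have h9 : P.val ≠ Q.val := fun h => hPQ (Fin.ext h)
  rcases Nat.eq_zero_or_pos P.val with h | h
  · have := h2 (Q.val + 1) (by omega) (by omega)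
    omega
  · have := h2 (P.val + 1) (by omega) (by omega)
    omega

theorem not_isContained_compl_extremalGraph {q a k n : ℕ} (hk : 2 ≤ k) (hkn : k ≤ n)
    (han : a - 1 < n) : ¬ (bookGraph k n).IsContained (extremalGraph q a n)ᶜ := by
  rintro ⟨f⟩
  have hadj : ∀ v w : Fin n, v ≠ w → v.val < k → ¬ (extremalGraph q a n).Adj (f v) (f w) := by
    intro v w hvw hv
    have h : (extremalGraph q a n)ᶜ.Adj (f v) (f w) := f.toHom.map_rel ⟨hvw, Or.inl hv⟩
    exact ((SimpleGraph.compl_adj _ _ _).1 h).2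
  have hinj : Function.Injective f := f.injective
  have h0 : ∀ v, (f v).1 = (f ⟨0, by omega⟩).1 := by
    intro v
    by_cases hv : ⟨0, by omega⟩ = v
    · rw [hv]
    · by_contra hne
      exact hadj _ v hv (show 0 < k by omega) (Or.inl fun h => hne h.symm)
  set i := (f ⟨0, by omega⟩).1 with hi
  let g : Fin n → Fin (extremalPartSize q a n i) := fun v =>
    ⟨(f v).2.val, (f v).2.2.trans_eq (congrArg _ (h0 v))⟩
  have hg : Function.Injective g := by
    intro v w hvw
    apply hinj
    have h1 := (h0 v).trans (h0 w).symm
    refine Sigma.ext h1 ?_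
    rw [Fin.heq_ext_iff (by rw [h1])]
    simpa [g] using hvw
  have hcard := Fintype.card_le_of_injective _ hg
  rw [Fintype.card_fin, Fintype.card_fin] at hcard
  have hil : i = Fin.last (q + 1) := by
    unfold extremalPartSize at hcard
    split_ifs at hcard with h1 h2
    · omega
    · exact h2
    · omega
  have hsz : extremalPartSize q a n i = n := by
    rw [hil]; simp [extremalPartSize, Fin.ext_iff]
  have hsurj : Function.Surjective g :=
    ((Fintype.bijective_iff_injective_and_card g).2 ⟨hg, by simp [hsz]⟩).2
  -- a vertex of the spine is unmatched, so it is the last vertex of the part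
  have hend : ∀ v : Fin n, v.val < k → (g v).val + 1 = n := by
    intro v hv
    by_contra hne
    have hlt := (g v).2
    have hw : ∃ w : Fin (extremalPartSize q a n i), w ≠ g v ∧ (g v).val / 2 = w.val / 2 := by
      rcases Nat.even_or_odd' (g v).val with ⟨c, hc | hc⟩
      · refine ⟨⟨(g v).val + 1, by omega⟩, fun h => ?_, ?_⟩
        · have := congrArg Fin.val h
          simp at this
        · simp only; omega
      · refine ⟨⟨(g v).val - 1, by omega⟩, fun h => ?_, ?_⟩
        · have := congrArg Fin.val h
          simp only at this
          omega
        · simp only; omega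
    obtain ⟨w', hw', hhalf⟩ := hw
    obtain ⟨w, rfl⟩ := hsurj w'
    have hvw : v ≠ w := fun h => hw' (by rw [h])
    exact hadj v w hvw hv (Or.inr ⟨(h0 v).trans hil, fun h => hvw (hinj h), hhalf⟩)
  have h1 := hend ⟨0, by omega⟩ (by simp only; omega)
  have h2 := hend ⟨1, by omega⟩ (by simp only; omega)
  have h3 := hg (Fin.ext (Nat.succ_injective (h1.trans h2.symm)))
  simp at h3

theorem lt_ramseyNumber_of_two_le {p k n : ℕ} {a : ℕ → ℕ} (hp : 2 ≤ p) (hk : 2 ≤ k) (hkn : k ≤ n)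
    (ha1 : 1 ≤ a 1) (han : a 1 ≤ n) (hle : ∀ i, 1 ≤ i → i ≤ p → a 1 ≤ a i)
    (h2 : ∀ i, 2 ≤ i → i ≤ p → 2 ≤ a i) :
    (p - 1) * (n - 1) + a 1 < ramseyNumber (completePartite p a) (bookGraph k n) := by
  obtain ⟨q, rfl⟩ : ∃ q, p = q + 2 := ⟨p - 2, by omega⟩
  have h := lt_ramseyNumber (extremalGraph q (a 1) n)
    (not_isContained_extremalGraph (n := n) ha1 hle h2)
    (not_isContained_compl_extremalGraph (k := k) hk hkn (by omega))
  rwa [card_extremalGraph _ _ _ ha1 (by omega)] at h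

/-! ### Choice of the constants -/

section Constants

theorem mul_inv_two_pow_le {x : ℝ} {A B C : ℕ} (hx : x ≤ 2 ^ C) (h : B + C ≤ A) :
    x * ((2 : ℝ) ^ A)⁻¹ ≤ ((2 : ℝ) ^ B)⁻¹ := by
  rw [← div_eq_mul_inv, div_le_iff₀ (by positivity), inv_mul_eq_div, le_div_iff₀ (by positivity)]
  calc x * 2 ^ B ≤ 2 ^ C * 2 ^ B := by gcongr
    _ = 2 ^ (B + C) := by rw [← pow_add, add_comm]
    _ ≤ 2 ^ A := by gcongr; norm_num

theorem inv_two_pow_lt {A B : ℕ} (h : A < B) : ((2 : ℝ) ^ B)⁻¹ < ((2 : ℝ) ^ A)⁻¹ := by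
  gcongr
  norm_num

theorem half_inv_two_pow (E : ℕ) : ((2 : ℝ) ^ E)⁻¹ / 2 = ((2 : ℝ) ^ (E + 1))⁻¹ := by
  rw [pow_succ, mul_inv]
  rfl

theorem cast_le_two_pow {a b : ℕ} (h : a ≤ b) : (a : ℝ) ≤ 2 ^ b := by
  exact_mod_cast h.trans Nat.lt_two_pow_self.le

variable {V : Type*} [Fintype V] [Nonempty V]

/-- The density of `j`-cliques is bounded below for all `j ≤ r`, by iterating `le_density_clique_succ`. -/
theorem inv_two_pow_le_density_clique (Γ : SimpleGraph V) {r k Q : ℕ} {ν : ℝ}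
    (hν : ∀ g : Fin k → V, (∀ a b, a ≠ b → g a ≠ g b ∧ ¬ Γ.Adj (g a) (g b)) →
      density (fun v => ∀ a, ¬ Γ.Adj v (g a)) ≤ ν) (hQ : 16 ≤ Q) (hrQ : r ≤ Q) (hkQ : k ≤ Q)
    (hkrQ : ∀ j, j < r → k ^ j ≤ Q)
    (hgap : ∀ j, j < r → j * ν + k ^ j * (1 / (Q : ℝ) ^ 2) < 1)
    (hN : 1 / (Fintype.card V : ℝ) ≤ ((2 : ℝ) ^ ((4 * Q) ^ r))⁻¹) :
    ∀ j, 1 ≤ j → j ≤ r →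
      ((2 : ℝ) ^ ((4 * Q) ^ j))⁻¹ ≤ density fun y : Fin j → V => IsCliqueTuple Γ y := by
  intro j hj
  induction j, hj using Nat.le_induction with
  | base =>
    intro _
    have h1 : density (fun y : Fin 1 → V => IsCliqueTuple Γ y) = 1 := by
      have : ∀ y : Fin 1 → V, IsCliqueTuple Γ y ↔ True :=
        fun y => ⟨fun _ => trivial, fun _ i i' h => absurd (Subsingleton.elim i i') h⟩
      rw [density_congr this]
      simp [density]
    rw [h1]
    exact inv_le_one_of_one_le₀ (one_le_pow₀ (by norm_num))
  | succ j hj ih =>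
    intro hjr
    set E := (4 * Q) ^ j with hE
    have hQ0 : (0 : ℝ) < Q := by positivity
    have hE4 : 4 ≤ E := by
      calc 4 ≤ (4 * Q) ^ 1 := by rw [pow_one]; omega
        _ ≤ E := Nat.pow_le_pow_right (by omega) hj
    have hkj := hkrQ j (by omega)
    have hjQ : j ≤ Q := by omega
    have hsucc : (4 * Q) ^ (j + 1) = E * (4 * Q) := pow_succ _ _
    have hEQ : 4 * Q ≤ E * Q := by gcongr
    refine le_density_clique_succ Γ (α := ((2 : ℝ) ^ E)⁻¹) (θ := 1 / (Q : ℝ) ^ 2) hν (by positivity)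
      (ih (by omega)) (by positivity) (hgap j (by omega)) ?_ ?_
    · rw [half_inv_two_pow, one_div, ← div_eq_inv_mul, le_div_iff₀ (by positivity), mul_comm]
      refine mul_inv_two_pow_le (C := Q * 2) ?_ ?_
      · rw [pow_mul]
        gcongr
        exact cast_le_two_pow le_rfl
      · rw [hsucc]
        nlinarith
    · have h1 : 1 / (Fintype.card V : ℝ) ≤ ((2 : ℝ) ^ ((4 * Q) ^ (j + 1)))⁻¹ := by
        refine hN.trans ?_
        gcongr
        · norm_num
        · omega
      rw [half_inv_two_pow, inv_pow, ← pow_mul]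
      have hB : (E + 1) * k ^ j ≤ E * Q + Q := by
        calc (E + 1) * k ^ j ≤ (E + 1) * Q := by gcongr
          _ = _ := by ring
      calc (j : ℝ) * k ^ 2 * (((2 : ℝ) ^ ((4 * Q) ^ (j + 1)))⁻¹ + 1 / Fintype.card V)
          ≤ (Q : ℝ) * Q ^ 2 * (((2 : ℝ) ^ ((4 * Q) ^ (j + 1)))⁻¹ +
            ((2 : ℝ) ^ ((4 * Q) ^ (j + 1)))⁻¹) := by gcongr
        _ = ((Q : ℝ) ^ 3 * 2) * ((2 : ℝ) ^ ((4 * Q) ^ (j + 1)))⁻¹ := by ring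
        _ ≤ ((2 : ℝ) ^ (E * Q + Q + 1))⁻¹ := by
          refine mul_inv_two_pow_le (C := Q * 3 + 1) ?_ ?_
          · rw [pow_succ _ (Q * 3), pow_mul]
            gcongr
            exact cast_le_two_pow le_rfl
          · rw [hsucc]
            nlinarith
        _ < _ := inv_two_pow_lt (by omega)

theorem add_pow_three_le_pow {Q P E : ℕ} (hQ : 16 ≤ Q) (hP : 4 ≤ P) (hE : E ≤ Q ^ P) :
    E + 1 + (24 * Q ^ 3 + 1) ≤ Q ^ (20 * P) := by
  have h1 : 24 * Q ^ 3 + 2 ≤ Q ^ (2 * P) := by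
    calc 24 * Q ^ 3 + 2 ≤ 24 * Q ^ 3 + 2 * Q ^ 3 := by
          have : 1 ≤ Q ^ 3 := Nat.one_le_pow _ _ (by omega)
          omega
      _ = 26 * Q ^ 3 := by ring
      _ ≤ Q ^ 2 * Q ^ 3 := by gcongr; nlinarith
      _ = Q ^ 5 := by ring
      _ ≤ Q ^ (2 * P) := Nat.pow_le_pow_right (by omega) (by omega)
  have h2 : Q ^ P ≤ Q ^ (2 * P) := Nat.pow_le_pow_right (by omega) (by omega)
  have h3 : 2 * Q ^ (2 * P) ≤ Q ^ (20 * P) := by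
    calc 2 * Q ^ (2 * P) ≤ Q * Q ^ (2 * P) := by gcongr; omega
      _ = Q ^ (2 * P + 1) := by ring
      _ ≤ _ := Nat.pow_le_pow_right (by omega) (by omega)
  omega

theorem mul_add_pow_two_le_pow {Q P E x : ℕ} (hQ : 16 ≤ Q) (hP : 4 ≤ P) (hE : E ≤ Q ^ P)
    (hx : x ≤ Q ^ (8 * P)) : (E + 1) * x + 1 + 18 * Q ^ 2 ≤ Q ^ (20 * P) := by
  have h1 : (E + 1) * x ≤ 2 * Q ^ (9 * P) := by
    calc (E + 1) * x ≤ (Q ^ P + Q ^ P) * Q ^ (8 * P) := by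
          have : 1 ≤ Q ^ P := Nat.one_le_pow _ _ (by omega)
          gcongr
      _ = 2 * Q ^ (9 * P) := by ring
  have h2 : 1 + 18 * Q ^ 2 ≤ Q ^ (9 * P) := by
    calc 1 + 18 * Q ^ 2 ≤ 19 * Q ^ 2 := by
          have : 1 ≤ Q ^ 2 := Nat.one_le_pow _ _ (by omega)
          omega
      _ ≤ Q ^ 2 * Q ^ 2 := by gcongr; nlinarith
      _ = Q ^ 4 := by ring
      _ ≤ _ := Nat.pow_le_pow_right (by omega) (by omega)
  have h3 : 3 * Q ^ (9 * P) ≤ Q ^ (20 * P) := by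
    calc 3 * Q ^ (9 * P) ≤ Q * Q ^ (9 * P) := by gcongr; omega
      _ = Q ^ (9 * P + 1) := by ring
      _ ≤ _ := Nat.pow_le_pow_right (by omega) (by omega)
  omega

theorem pow_add_mul_le_two_pow {Q k K s : ℕ} (hQ : 16 ≤ Q) (hkQ : k ≤ Q) (hKQ : K ≤ Q)
    (hk : 1 ≤ k) (hs : s = Q ^ (8 * k)) :
    s ^ (k + 1 + K) + K * s ≤ 2 ^ (24 * Q ^ 3 + 1) := by
  have hQs : Q ≤ s := hs ▸ Nat.le_self_pow (by omega) Q
  have h1 : K * s ≤ s ^ (k + 1 + K) := by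
    calc K * s ≤ s * s := Nat.mul_le_mul_right _ (hKQ.trans hQs)
      _ = s ^ 2 := by ring
      _ ≤ _ := Nat.pow_le_pow_right (by omega) (by omega)
  have h2 : s ^ (k + 1 + K) ≤ 2 ^ (24 * Q ^ 3) := by
    calc s ^ (k + 1 + K) = Q ^ (8 * k * (k + 1 + K)) := by rw [hs, ← pow_mul]
      _ ≤ (2 ^ Q) ^ (8 * k * (k + 1 + K)) := Nat.pow_le_pow_left Nat.lt_two_pow_self.le _
      _ = 2 ^ (Q * (8 * k * (k + 1 + K))) := (pow_mul _ _ _).symm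
      _ ≤ 2 ^ (Q * (8 * Q * (3 * Q))) := by
        gcongr
        · norm_num
        · omega
      _ = _ := by congr 1; ring
  rw [pow_succ]
  omega

theorem mul_sq_mul_two_le_two_pow {Q k s : ℕ} (hQ : 16 ≤ Q) (hkQ : k ≤ Q)
    (hs : s = Q ^ (8 * k)) : Q * s ^ 2 * 2 ≤ 2 ^ (18 * Q ^ 2) := by
  calc Q * s ^ 2 * 2 = Q ^ (16 * k + 1) * 2 := by rw [hs]; ring
    _ ≤ (2 ^ Q) ^ (16 * k + 1) * 2 := by
      gcongr
      exact Nat.lt_two_pow_self.le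
    _ = 2 ^ (Q * (16 * k + 1) + 1) := by rw [pow_succ 2, ← pow_mul]
    _ ≤ _ := Nat.pow_le_pow_right (by norm_num) (by nlinarith)

/-- The error terms in the sizes of the nearly complete sets add up to at most about half of the
extremal size `ν`, which is close to `1 / K`. -/
theorem half_inv_le_size {Q k K s : ℕ} {ν β : ℝ} (hQ : 16 ≤ Q) (hkQ : k ≤ Q) (hKQ : K ≤ Q)
    (hk : 2 ≤ k) (hK : 1 ≤ K) (hs : s = Q ^ (8 * k)) (hβ0 : 0 ≤ β) (hβ : β ≤ 1 / s)
    (hKν : K * ν = 1 - β) :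
    1 / (2 * (K : ℝ)) ≤ ν - K * ((k + 1) / s) - K * (1 / (s : ℝ) ^ (k + 1 + K) +
        (K * ((k + 1) / s) + k ^ 2 * (1 / s + β) + k * (1 / s)) / (1 / (Q : ℝ) ^ 4) ^ k) := by
  have hs1 : 1 ≤ s := hs ▸ Nat.one_le_pow _ _ (by omega)
  have hs0 : (0 : ℝ) < s := by exact_mod_cast hs1
  have hQ16 : (16 : ℝ) ≤ Q := by exact_mod_cast hQ
  have hK0 : (0 : ℝ) < K := by exact_mod_cast hK
  have hKQ' : (K : ℝ) ≤ Q := by exact_mod_cast hKQ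
  have hkQ' : (k : ℝ) ≤ Q := by exact_mod_cast hkQ
  have hsQ : (18 : ℝ) * Q ^ (4 * k + 4) * (1 / s) ≤ 1 := by
    rw [mul_one_div, div_le_one hs0]
    have h1 : 18 * Q ^ (4 * k + 4) ≤ s := by
      calc 18 * Q ^ (4 * k + 4) ≤ Q ^ 2 * Q ^ (4 * k + 4) := by gcongr; nlinarith
        _ = Q ^ (4 * k + 6) := by ring
        _ ≤ s := hs ▸ Nat.pow_le_pow_right (by omega) (by omega)
    exact_mod_cast h1
  have hεσ : 1 / (s : ℝ) ^ (k + 1 + K) ≤ 1 / s := by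
    gcongr
    exact le_self_pow₀ (by exact_mod_cast hs1) (by omega)
  have hω : (K : ℝ) * ((k + 1) / s) ≤ 2 * Q ^ 2 * (1 / s) := by
    calc (K : ℝ) * ((k + 1) / s) = K * (k + 1) * (1 / s) := by ring
      _ ≤ Q * (Q + Q) * (1 / s) := by gcongr; linarith
      _ = _ := by ring
  have hω0 : 0 ≤ (K : ℝ) * ((k + 1) / s) := by positivity
  generalize (K : ℝ) * ((k + 1) / s) = ω at *
  have hε0 : 0 ≤ 1 / (s : ℝ) ^ (k + 1 + K) := by positivity
  generalize 1 / (s : ℝ) ^ (k + 1 + K) = ε at *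
  have hσ0 : 0 < 1 / (s : ℝ) := by positivity
  generalize 1 / (s : ℝ) = σ at *
  have hX : (ω + k ^ 2 * (σ + β) + k * σ) / (1 / (Q : ℝ) ^ 4) ^ k ≤
      5 * Q ^ (4 * k + 2) * σ := by
    rw [one_div, inv_pow, div_inv_eq_mul, ← pow_mul]
    calc _ ≤ (2 * Q ^ 2 * σ + Q ^ 2 * (σ + σ) + Q ^ 2 * σ) * (Q : ℝ) ^ (4 * k) := by
          gcongr
          exact hkQ'.trans (le_self_pow₀ (by linarith) (by norm_num))
      _ = _ := by ring
  have hX0 : 0 ≤ (ω + k ^ 2 * (σ + β) + k * σ) / (1 / (Q : ℝ) ^ 4) ^ k := by positivity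
  generalize (ω + k ^ 2 * (σ + β) + k * σ) / (1 / (Q : ℝ) ^ 4) ^ k = X at *
  have hQ1 : (1 : ℝ) ≤ Q ^ (4 * k) := one_le_pow₀ (by linarith)
  have hsum : (K : ℝ) * (ω + K * (ε + X)) ≤ 8 * Q ^ (4 * k + 4) * σ := by
    calc _ ≤ (Q : ℝ) * (2 * Q ^ 2 * σ + Q * (σ + 5 * Q ^ (4 * k + 2) * σ)) := by gcongr
      _ = (2 * Q ^ 3 + Q ^ 2) * 1 * σ + 5 * Q ^ (4 * k + 4) * σ := by ring
      _ ≤ (3 * Q ^ 4) * Q ^ (4 * k) * σ + 5 * Q ^ (4 * k + 4) * σ := by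
        gcongr
        have h1 : (Q : ℝ) ^ 3 ≤ Q ^ 4 := pow_le_pow_right₀ (by linarith) (by norm_num)
        have h2 : (Q : ℝ) ^ 2 ≤ Q ^ 4 := pow_le_pow_right₀ (by linarith) (by norm_num)
        linarith
      _ = _ := by ring
  have hone : σ ≤ Q ^ (4 * k + 4) * σ :=
    le_mul_of_one_le_left hσ0.le (one_le_pow₀ (by linarith))
  rw [div_le_iff₀ (by positivity)]
  linarith

theorem two_mul_add_le_div {N Q m x y P : ℕ} (hQ : 16 ≤ Q) (hP : 1 ≤ P) (hx : x ≤ Q) (hy : y ≤ Q)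
    (hy0 : 0 < y) (hN : m * 2 ^ (Q ^ (30 * P)) ≤ N) :
    2 * (m + x * (N / Q ^ 4)) ≤ N / (2 * y) := by
  rw [Nat.le_div_iff_mul_le (by positivity)]
  have h1 : N / Q ^ 4 * Q ^ 4 ≤ N := Nat.div_mul_le_self _ _
  generalize N / Q ^ 4 = h at *
  have h2 : 8 * Q * m ≤ N := by
    refine le_trans ?_ hN
    rw [mul_comm]
    gcongr
    calc 8 * Q ≤ Q * Q := by gcongr; omega
      _ = Q ^ 2 := by ring
      _ ≤ Q ^ (30 * P) := Nat.pow_le_pow_right (by omega) (by omega)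
      _ ≤ _ := Nat.lt_two_pow_self.le
  have h3 : 8 * Q ^ 2 * h ≤ N := by
    refine le_trans ?_ h1
    rw [mul_comm]
    gcongr
    calc 8 * Q ^ 2 ≤ Q ^ 2 * Q ^ 2 := by gcongr; nlinarith
      _ = Q ^ 4 := by ring
  calc 2 * (m + x * h) * (2 * y) ≤ 2 * (m + Q * h) * (2 * Q) := by gcongr
    _ = 4 * Q * m + 4 * Q ^ 2 * h := by ring
    _ ≤ N := by linarith

theorem hasParts_of_density_nearly_complete (Γ : SimpleGraph V) {r k n t m Q : ℕ} {a : ℕ → ℕ}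
    (hk : 0 < k) (ha1 : a 1 = 1) (ha2 : a 2 = 1) (hat : ∀ i, i + 1 < r → a (i + 3) ≤ t)
    (ham : ∀ i, i < r → a (i + 3) ≤ m) (hN : (r + 1) * (n - 1) < Fintype.card V)
    (hbook : ComplBookFree Γ k n) (T : Fin (r + 1) → V → Prop)
    (hT : ∀ i, 1 / (2 * ((r + 1 : ℕ) : ℝ)) ≤ density (T i)) (hQ : 0 < Q)
    (hTT : ∀ i j, j ≠ i → ∀ v, T i v →
      density (fun x => T j x ∧ ¬ Γ.Adj v x) ≤ 1 / (Q : ℝ) ^ 4)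
    (hm : 0 < m) (hsize : 2 * (m + (r * t + 1) * (Fintype.card V / Q ^ 4)) ≤
      Fintype.card V / (2 * ((r + 1) * k))) :
    HasParts Γ (r + 2) a := by
  classical
  refine hasParts_of_nearly_complete Γ (q := Fintype.card V / (2 * ((r + 1) * k)))
    (h := Fintype.card V / Q ^ 4) hk ha1 ha2 hat ham hN hbook
    (fun i => Finset.univ.filter (T i)) (fun i => ?_) (fun i j hij v hv => ?_) hm hsize
  · have h1 : (Fintype.card V : ℝ) ≤ (Finset.univ.filter (T i)).card * (2 * (r + 1 : ℕ)) := by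
      rw [card_filter_eq_density]
      have := hT i
      rw [div_le_iff₀ (by positivity)] at this
      calc (Fintype.card V : ℝ) = 1 * Fintype.card V := (one_mul _).symm
        _ ≤ density (T i) * (2 * (r + 1 : ℕ)) * Fintype.card V := by gcongr
        _ = _ := by ring
    have h2 : Fintype.card V ≤ (Finset.univ.filter (T i)).card * (2 * (r + 1)) := by
      exact_mod_cast h1
    refine Nat.le_of_mul_le_mul_right (c := 2 * (r + 1)) ?_ (by omega)
    calc Fintype.card V / (2 * ((r + 1) * k)) * k * (2 * (r + 1))
        = Fintype.card V / (2 * ((r + 1) * k)) * (2 * ((r + 1) * k)) := by ring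
      _ ≤ Fintype.card V := Nat.div_mul_le_self _ _
      _ ≤ _ := h2
  · rw [Nat.le_div_iff_mul_le (by positivity), Finset.filter_filter]
    have h1 := hTT i j hij v (Finset.mem_filter.1 hv).2
    rw [le_div_iff₀ (by positivity)] at h1
    have h2 : ((Finset.univ.filter fun x => T j x ∧ ¬ Γ.Adj v x).card : ℝ) * Q ^ 4 ≤
        Fintype.card V := by
      rw [card_filter_eq_density, mul_right_comm]
      exact mul_le_of_le_one_left (Nat.cast_nonneg _) h1
    exact_mod_cast h2

/-- Few `(r + 1)`-cliques: the nearly complete pairs exist and carry the multipartite graph. -/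
theorem hasParts_of_few_cliques (Γ : SimpleGraph V) {r k t n m Q P : ℕ} {a : ℕ → ℕ}
    (hk : 2 ≤ k) (ht : 1 ≤ t) (ha1 : a 1 = 1) (ha2 : a 2 = 1)
    (hat : ∀ i, i + 1 < r → a (i + 3) ≤ t) (ham : ∀ i, i < r → a (i + 3) ≤ m) (hm : 0 < m)
    (hN : Fintype.card V = (r + 1) * (n - 1) + 1) (hbook : ComplBookFree Γ k n)
    {ν : ℝ} (hνdef : ν * Fintype.card V = (n - 1 : ℕ))
    (hν : ∀ g : Fin k → V, (∀ a b, a ≠ b → g a ≠ g b ∧ ¬ Γ.Adj (g a) (g b)) →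
      density (fun v => ∀ a, ¬ Γ.Adj v (g a)) ≤ ν)
    (hQ : 16 ≤ Q) (hrkt : (r + 1) * k * t ≤ Q) (hrP : k * (r + 2) = P)
    (hNlarge : m * 2 ^ (Q ^ (30 * P)) ≤ Fintype.card V)
    (hκ : ((2 : ℝ) ^ ((4 * Q) ^ (r + 1)))⁻¹ ≤
      density fun y : Fin (r + 1) → V => IsCliqueTuple Γ y)
    (hc : density (fun y : Fin (r + 2) → V => IsCliqueTuple Γ y) ≤
      ((2 : ℝ) ^ (Q ^ (20 * P)))⁻¹) :
    HasParts Γ (r + 2) a := by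
  classical
  have hN0 : (0 : ℝ) < Fintype.card V := by exact_mod_cast Fintype.card_pos
  have hKk : (r + 1) * k ≤ Q := le_trans (Nat.le_mul_of_pos_right _ ht) hrkt
  have hkQ : k ≤ Q := le_trans (Nat.le_mul_of_pos_left _ (Nat.succ_pos r)) hKk
  have hKQ : r + 1 ≤ Q := le_trans (Nat.le_mul_of_pos_right _ (by omega)) hKk
  have hrtQ : r * t + 1 ≤ Q := by nlinarith
  have hP : 4 ≤ P := by nlinarith
  have hkP : k ≤ P := by nlinarith
  have hKP : 2 * (r + 1) ≤ P := by nlinarith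
  have hkKP : k * (r + 1) ≤ P := by nlinarith
  have hEP : (4 * Q) ^ (r + 1) ≤ Q ^ P := by
    calc (4 * Q) ^ (r + 1) ≤ (Q ^ 2) ^ (r + 1) := Nat.pow_le_pow_left (by nlinarith) _
      _ = Q ^ (2 * (r + 1)) := (pow_mul _ _ _).symm
      _ ≤ Q ^ P := Nat.pow_le_pow_right (by omega) hKP
  obtain ⟨s, hs⟩ : ∃ s, s = Q ^ (8 * k) := ⟨_, rfl⟩
  have hs1 : 1 ≤ s := hs ▸ Nat.one_le_pow _ _ (by omega)
  have hs0 : (0 : ℝ) < s := by exact_mod_cast hs1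
  have hQs : Q ≤ s := hs ▸ Nat.le_self_pow (by omega) Q
  have hsK : s ^ (r + 1) ≤ Q ^ (8 * P) := by
    rw [hs, ← pow_mul]
    exact Nat.pow_le_pow_right (by omega) (by nlinarith)
  have hC1 := add_pow_three_le_pow hQ hP hEP
  have hC2 := mul_add_pow_two_le_pow hQ hP hEP hsK
  have hsC : s ≤ 2 ^ (Q ^ (20 * P)) := by
    rw [hs]
    exact (Nat.pow_le_pow_right (by omega) (by omega)).trans Nat.lt_two_pow_self.le
  have hCD : Q ^ (20 * P) ≤ Q ^ (30 * P) := Nat.pow_le_pow_right (by omega) (by omega)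
  have hsize := two_mul_add_le_div (x := r * t + 1) (y := (r + 1) * k) hQ (by omega) hrtQ
    hKk (by positivity) hNlarge
  have hNC : 1 / (Fintype.card V : ℝ) ≤ ((2 : ℝ) ^ (Q ^ (20 * P)))⁻¹ := by
    rw [one_div]
    gcongr
    have h1 : 1 * 2 ^ (Q ^ (20 * P)) ≤ Fintype.card V :=
      le_trans (Nat.mul_le_mul hm (Nat.pow_le_pow_right (by norm_num) hCD)) hNlarge
    rw [one_mul] at h1
    exact_mod_cast h1
  generalize Q ^ (20 * P) = C at *
  generalize (4 * Q) ^ (r + 1) = E at *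
  have hKν : ((r + 1 : ℕ) : ℝ) * ν = 1 - 1 / Fintype.card V := by
    have h1 : ((r + 1 : ℕ) : ℝ) * (ν * Fintype.card V) = Fintype.card V - 1 := by
      rw [hνdef, hN]
      push_cast
      ring
    field_simp
    linarith
  have hN1 : 0 < 1 / (Fintype.card V : ℝ) := by positivity
  have hν0 : 0 ≤ ν := by
    by_contra! hneg
    have h1 : (0 : ℝ) ≤ (n - 1 : ℕ) := by positivity
    nlinarith
  obtain ⟨A, hA, hAγ, hAA⟩ := exists_sparse_sets Γ (r := r + 1) (s := s) (ν := ν)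
    (ε := 1 / (s : ℝ) ^ (k + 1 + (r + 1))) (γ := 1 / (s : ℝ)) hν (by rw [hKν]; linarith)
    (by positivity) hκ hc (by positivity) (by positivity) (by
      rw [half_inv_two_pow, div_div_eq_mul_div, div_div_eq_mul_div, div_one, div_one]
      calc _ = ((s : ℝ) ^ (k + 1 + (r + 1)) + (r + 1 : ℕ) * s) * ((2 : ℝ) ^ C)⁻¹ := by ring
        _ ≤ _ := mul_inv_two_pow_le (by
          exact_mod_cast pow_add_mul_le_two_pow hQ hkQ hKQ (by omega) hs) hC1) (by
      rw [half_inv_two_pow, inv_pow, ← pow_mul]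
      calc ((r + 1 : ℕ) : ℝ) * s ^ 2 * (((2 : ℝ) ^ C)⁻¹ + 1 / Fintype.card V)
          ≤ (Q : ℝ) * s ^ 2 * (((2 : ℝ) ^ C)⁻¹ + ((2 : ℝ) ^ C)⁻¹) := by
            gcongr
        _ = ((Q : ℝ) * s ^ 2 * 2) * ((2 : ℝ) ^ C)⁻¹ := by ring
        _ ≤ ((2 : ℝ) ^ ((E + 1) * s ^ (r + 1) + 1))⁻¹ :=
          mul_inv_two_pow_le (by exact_mod_cast mul_sq_mul_two_le_two_pow hQ hkQ hs) hC2
        _ < _ := inv_two_pow_lt (by omega)) (hkQ.trans hQs) hs1 (by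
      rw [mul_one_div_cancel (by positivity)])
  obtain ⟨T, hT, hTT⟩ := exists_nearly_complete Γ (η := 1 / (Q : ℝ) ^ 4) hν0 hν (by positivity)
    (by positivity) (by positivity) (by positivity) A hA hAγ hAA
  have hNs : 1 / (Fintype.card V : ℝ) ≤ 1 / s := by
    refine hNC.trans ?_
    rw [one_div]
    gcongr
    exact_mod_cast hsC
  have hTK := fun i => (half_inv_le_size hQ hkQ hKQ hk (by omega) hs hN1.le hNs hKν).trans (hT i)
  exact hasParts_of_density_nearly_complete Γ (by omega) ha1 ha2 hat ham (hN ▸ Nat.lt_succ_self _)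
    hbook T hTK (by omega) hTT hm hsize

/-- Many `(r + 1)`-cliques contain the multipartite graph, whose last part may have linear size. -/
theorem hasParts_of_many_cliques (Γ : SimpleGraph V) {r t m Q P : ℕ} {a : ℕ → ℕ}
    (hat : ∀ i, i < r → a (i + 1) ≤ t) (ham : a (r + 1) ≤ m) (hm : 0 < m) (hQ : 16 ≤ Q)
    (htrQ : t ^ r ≤ Q) (hrt : r * t ≤ Q) (htQ : t ≤ Q) (hP : 1 ≤ P)
    (hNlarge : m * 2 ^ (Q ^ (30 * P)) ≤ Fintype.card V)
    (hc : ((2 : ℝ) ^ (Q ^ (20 * P)))⁻¹ ≤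
      density fun y : Fin (r + 1) → V => IsCliqueTuple Γ y) :
    HasParts Γ (r + 1) a := by
  classical
  have hN0 : (0 : ℝ) < Fintype.card V := by exact_mod_cast Fintype.card_pos
  set C := Q ^ (20 * P) with hC
  set D := Q ^ (30 * P) with hD
  have hCD : C * Q + Q ^ 2 ≤ D := by
    have h1 : C * Q + Q ^ 2 ≤ Q ^ (20 * P + 1) + Q ^ (20 * P + 1) := by
      rw [pow_succ]
      refine Nat.add_le_add_left ?_ _
      calc Q ^ 2 ≤ Q ^ (20 * P + 1) := Nat.pow_le_pow_right (by omega) (by omega)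
        _ = _ := pow_succ _ _
    calc C * Q + Q ^ 2 ≤ 2 * Q ^ (20 * P + 1) := by omega
      _ ≤ Q * Q ^ (20 * P + 1) := by gcongr; omega
      _ = Q ^ (20 * P + 2) := by ring
      _ ≤ D := Nat.pow_le_pow_right (by omega) (by omega)
  have hpow : ((2 : ℝ) ^ (C * Q))⁻¹ ≤ (((2 : ℝ) ^ C)⁻¹) ^ (t ^ r) := by
    rw [inv_pow, ← pow_mul]
    gcongr
    norm_num
  have hNl : (m : ℝ) * 2 ^ D ≤ Fintype.card V := by exact_mod_cast hNlarge
  have hmain : (m : ℝ) ≤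
      ((((2 : ℝ) ^ C)⁻¹) ^ (t ^ r) - r * t ^ 2 / Fintype.card V) * Fintype.card V := by
    rw [sub_mul, div_mul_cancel₀ _ hN0.ne']
    have h1 : (m : ℝ) * 2 ^ (Q ^ 2) ≤ (((2 : ℝ) ^ C)⁻¹) ^ (t ^ r) * Fintype.card V := by
      calc (m : ℝ) * 2 ^ (Q ^ 2) = ((2 : ℝ) ^ (C * Q))⁻¹ * (m * 2 ^ (C * Q + Q ^ 2)) := by
            rw [pow_add]
            field_simp
        _ ≤ ((2 : ℝ) ^ (C * Q))⁻¹ * (m * 2 ^ D) := by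
          gcongr
          norm_num
        _ ≤ _ := by gcongr
    have h2 : ((r * t ^ 2 : ℕ) : ℝ) + 1 ≤ 2 ^ (Q ^ 2) := by
      have h3 : r * t ^ 2 + 1 ≤ 2 ^ (Q ^ 2) := by
        have : r * t ^ 2 ≤ Q ^ 2 := by
          calc r * t ^ 2 = (r * t) * t := by ring
            _ ≤ Q * Q := by gcongr
            _ = Q ^ 2 := by ring
        exact Nat.succ_le_of_lt (this.trans_lt Nat.lt_two_pow_self)
      exact_mod_cast h3
    have h3 : (1 : ℝ) ≤ m := by exact_mod_cast hm
    push_cast at h2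
    have h4 : 0 ≤ (r : ℝ) * t ^ 2 := by positivity
    nlinarith
  have hm0 : (0 : ℝ) < m := by exact_mod_cast hm
  have hpos : 0 < (((2 : ℝ) ^ C)⁻¹) ^ (t ^ r) - r * t ^ 2 / Fintype.card V :=
    pos_of_mul_pos_left (hm0.trans_le hmain) hN0.le
  obtain ⟨u, hu, hinj, hz⟩ := exists_blowup_linear_part Γ (by positivity) hc hpos
  set Z : Finset V := Finset.univ.filter fun z => ∀ f : Fin r → Fin t, ∀ i, Γ.Adj z (u i (f i))
    with hZ
  have hZm : m ≤ Z.card := by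
    have h1 := card_filter_eq_density fun z => ∀ f : Fin r → Fin t, ∀ i, Γ.Adj z (u i (f i))
    have h2 : (m : ℝ) ≤ Z.card := by
      rw [hZ, h1]
      exact hmain.trans (mul_le_mul_of_nonneg_right hz hN0.le)
    exact_mod_cast h2
  refine ⟨Fin.snoc (fun i : Fin r => Finset.univ.image (u i)) Z, fun x => ?_, fun x y => ?_⟩
  · refine Fin.lastCases ?_ (fun x => ?_) x
    · simpa using ham.trans hZm
    · simpa [Finset.card_image_of_injective _ (hinj x)] using hat x.val x.2
  · refine Fin.lastCases (fun h => ?_) (fun x => ?_) x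
    · exact absurd h (not_lt.2 (Fin.le_last y))
    · refine Fin.lastCases (fun _ => ?_) (fun y h => ?_) y
      · intro z hz z' hz'
        simp only [Fin.snoc_castSucc, Fin.snoc_last, Finset.mem_image] at hz hz'
        obtain ⟨b, -, rfl⟩ := hz
        exact ((Finset.mem_filter.1 hz').2 (fun _ => b) x).symm
      · intro z hz z' hz'
        simp only [Fin.snoc_castSucc, Finset.mem_image] at hz hz'
        obtain ⟨b, -, rfl⟩ := hz
        obtain ⟨b', -, rfl⟩ := hz'
        have hne : x ≠ y := (Fin.castSucc_lt_castSucc_iff.1 h).ne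
        have := hu (fun i => if i = x then b else b') x y hne
        simpa [hne.symm] using this

end Constants

/-! ### The Ramsey number -/

theorem mul_le_pow_of_two_le {t x : ℕ} (ht : 2 ≤ t) : x * t ≤ t ^ x := by
  rcases x with _ | x
  · simp
  · rw [pow_succ]
    gcongr
    exact Nat.lt_two_pow_self.trans_le (Nat.pow_le_pow_left ht x)

/-- The upper bound: the parts exist whenever the complement contains no book. -/
theorem hasParts_of_complBookFree {V : Type*} [Fintype V] (Γ : SimpleGraph V) {k p t n : ℕ}
    {a : ℕ → ℕ} (hk : 2 ≤ k) (hp : 3 ≤ p) (ht : 2 ≤ t) (ha1 : a 1 = 1) (ha2 : a 2 = 1)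
    (hat : ∀ i, 1 ≤ i → i < p → a i ≤ t) (hap : 1 ≤ a p)
    (han : a p * 2 ^ (t ^ (1000 * k ^ 2 * p ^ 2)) ≤ n)
    (hN : Fintype.card V = (p - 1) * (n - 1) + 1) (hbook : ComplBookFree Γ k n) :
    HasParts Γ p a := by
  have : Nonempty V := Fintype.card_pos_iff.1 (by omega)
  obtain ⟨r, rfl⟩ : ∃ r, p = r + 2 := ⟨p - 2, by omega⟩
  rw [show r + 2 - 1 = r + 1 by omega] at hN
  set P := k * (r + 2) with hP
  have hP6 : 6 ≤ P := by nlinarith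
  obtain ⟨Q, hQ⟩ : ∃ Q, Q = t ^ P := ⟨_, rfl⟩
  have hQ16 : 16 ≤ Q := by
    calc 16 = 2 ^ 4 := by norm_num
      _ ≤ t ^ 4 := Nat.pow_le_pow_left ht 4
      _ ≤ Q := hQ ▸ Nat.pow_le_pow_right (by omega) (by omega)
  have hPt : P * t ≤ Q := hQ ▸ mul_le_pow_of_two_le ht
  have hPQ : P ≤ Q := le_trans (Nat.le_mul_of_pos_right _ (by omega)) hPt
  have hrkt : (r + 1) * k * t ≤ Q := by
    refine le_trans ?_ hPt
    gcongr
    nlinarith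
  have hkQ : k ≤ Q := le_trans (by nlinarith) hPQ
  have hrQ : r + 1 ≤ Q := le_trans (by nlinarith) hPQ
  have htQ : t ≤ Q := le_trans (Nat.le_mul_of_pos_left _ (by omega)) hPt
  have hrt : (r + 1) * t ≤ Q := by
    refine le_trans ?_ hPt
    gcongr
    nlinarith
  have htrQ : t ^ (r + 1) ≤ Q := hQ ▸ Nat.pow_le_pow_right (by omega) (by nlinarith)
  have hkrQ : ∀ j, j < r + 1 → k ^ j ≤ Q := fun j hj => by
    calc k ^ j ≤ (t ^ k) ^ j :=
          Nat.pow_le_pow_left (Nat.lt_two_pow_self.le.trans (Nat.pow_le_pow_left ht k)) _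
      _ = t ^ (k * j) := (pow_mul _ _ _).symm
      _ ≤ Q := hQ ▸ Nat.pow_le_pow_right (by omega) (by rw [hP]; gcongr; omega)
  have hD : t + Q ^ (30 * P) ≤ t ^ (1000 * k ^ 2 * (r + 2) ^ 2) := by
    have h1 : t ^ (1000 * k ^ 2 * (r + 2) ^ 2) = Q ^ (1000 * P) := by
      rw [hQ, ← pow_mul, hP]
      congr 1
      ring
    rw [h1]
    have h2 : t ≤ Q ^ (30 * P) := htQ.trans (Nat.le_self_pow (by omega) Q)
    calc t + Q ^ (30 * P) ≤ 2 * Q ^ (30 * P) := by omega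
      _ ≤ Q * Q ^ (30 * P) := by gcongr; omega
      _ = Q ^ (30 * P + 1) := by ring
      _ ≤ _ := Nat.pow_le_pow_right (by omega) (by omega)
  generalize t ^ (1000 * k ^ 2 * (r + 2) ^ 2) = D at *
  have hn1 : 1 ≤ n := le_trans (Nat.mul_pos hap (by positivity)) han
  have hnN : n ≤ Fintype.card V := by
    rw [hN]
    have : n - 1 ≤ (r + 1) * (n - 1) := Nat.le_mul_of_pos_left _ (by omega)
    omega
  set m := max t (a (r + 2)) with hm
  have hm0 : 0 < m := by omega
  have hNlarge : m * 2 ^ (Q ^ (30 * P)) ≤ Fintype.card V := by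
    refine le_trans ?_ (han.trans hnN)
    rcases max_cases t (a (r + 2)) with ⟨h, -⟩ | ⟨h, -⟩
    · rw [hm, h]
      calc t * 2 ^ (Q ^ (30 * P)) ≤ 2 ^ t * 2 ^ (Q ^ (30 * P)) := by
            gcongr
            exact Nat.lt_two_pow_self.le
        _ = 2 ^ (t + Q ^ (30 * P)) := (pow_add _ _ _).symm
        _ ≤ 1 * 2 ^ D := by rw [one_mul]; exact Nat.pow_le_pow_right (by norm_num) hD
        _ ≤ _ := Nat.mul_le_mul_right _ hap
    · rw [hm, h]
      gcongr
      · norm_num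
      · omega
  by_cases hmany : ((2 : ℝ) ^ (Q ^ (20 * P)))⁻¹ ≤
      density fun y : Fin (r + 2) → V => IsCliqueTuple Γ y
  · exact hasParts_of_many_cliques Γ (r := r + 1) (t := t) (m := m)
      (fun i hi => hat (i + 1) (by omega) (by omega)) (le_max_right _ _) hm0 hQ16 htrQ hrt htQ
      (by omega) hNlarge hmany
  have hN0 : (0 : ℝ) < Fintype.card V := by exact_mod_cast Fintype.card_pos
  let ν : ℝ := (n - 1 : ℕ) / Fintype.card V
  have hνdef : ν * Fintype.card V = (n - 1 : ℕ) := div_mul_cancel₀ _ hN0.ne'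
  have hν : ∀ g : Fin k → V, (∀ a b, a ≠ b → g a ≠ g b ∧ ¬ Γ.Adj (g a) (g b)) →
      density (fun v => ∀ a, ¬ Γ.Adj v (g a)) ≤ ν := by
    classical
    intro g hg
    rw [← mul_le_mul_iff_of_pos_right hN0, hνdef, ← card_filter_eq_density, Nat.cast_le]
    have := hbook g hg (Finset.univ.filter fun v => ∀ a, ¬ Γ.Adj v (g a))
      fun v hv => (Finset.mem_filter.1 hv).2
    omega
  have hν0 : 0 ≤ ν := by positivity
  have hκ := inv_two_pow_le_density_clique Γ (r := r + 1) hν hQ16 hrQ hkQ hkrQ ?_ ?_ (r + 1)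
    (by omega) le_rfl
  · exact hasParts_of_few_cliques Γ hk (by omega) ha1 ha2
      (fun i hi => hat (i + 3) (by omega) (by omega)) (m := m) (fun i hi => by
        rcases Nat.lt_or_ge (i + 1) r with h | h
        · exact (hat (i + 3) (by omega) (by omega)).trans (le_max_left _ _)
        · rw [show i + 3 = r + 2 by omega]
          exact le_max_right _ _) hm0 hN hbook hνdef hν hQ16 hrkt rfl hNlarge hκ
      (not_le.1 hmany).le
  · -- the common non-neighbourhoods of `j ≤ r` sets leave out more than `1 / (r + 1)` of the graph
    intro j hj
    have hQ0 : (0 : ℝ) < Q := by positivity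
    have h1 : (k : ℝ) ^ j * (1 / (Q : ℝ) ^ 2) ≤ 1 / (Q : ℝ) := by
      calc (k : ℝ) ^ j * (1 / (Q : ℝ) ^ 2) ≤ Q * (1 / (Q : ℝ) ^ 2) := by
            gcongr
            exact_mod_cast hkrQ j hj
        _ = 1 / (Q : ℝ) := by field_simp
    have h2 : (1 : ℝ) / Q ≤ 1 / (r + 1) := by
      gcongr
      exact_mod_cast hrQ
    have h3 : (j : ℝ) * ν ≤ r * ν := by
      gcongr
      omega
    have h4 : (r : ℝ) * ν + 1 / (r + 1) < 1 := by
      rw [← mul_lt_mul_iff_of_pos_right hN0, add_mul, mul_assoc, hνdef, one_mul]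
      have h5 : 1 / ((r : ℝ) + 1) * Fintype.card V < n := by
        rw [one_div, inv_mul_lt_iff₀ (by positivity), hN]
        push_cast [Nat.cast_sub hn1]
        have : (1 : ℝ) ≤ r := by exact_mod_cast (by omega : 1 ≤ r)
        linarith
      have h6 : (Fintype.card V : ℝ) = (r + 1) * (n - 1 : ℕ) + 1 := by
        rw [hN]; push_cast; ring
      rw [h6] at h5 ⊢
      push_cast [Nat.cast_sub hn1] at h5 ⊢
      linarith
    linarith
  · rw [one_div]
    gcongr
    have h1 : (4 * Q) ^ (r + 1) ≤ Q ^ (30 * P) := by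
      calc (4 * Q) ^ (r + 1) ≤ (Q ^ 2) ^ (r + 1) := Nat.pow_le_pow_left (by nlinarith) _
        _ = Q ^ (2 * (r + 1)) := (pow_mul _ _ _).symm
        _ ≤ _ := Nat.pow_le_pow_right (by omega) (by nlinarith)
    have h2 : 1 * 2 ^ ((4 * Q) ^ (r + 1)) ≤ Fintype.card V :=
      le_trans (Nat.mul_le_mul hm0 (Nat.pow_le_pow_right (by norm_num) h1)) hNlarge
    rw [one_mul] at h2
    exact_mod_cast h2

/-- For `p = 2` the multipartite graph is a single edge. -/
theorem hasParts_two_of_complBookFree {V : Type*} [Fintype V] (Γ : SimpleGraph V) {k n : ℕ}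
    {a : ℕ → ℕ} (hkn : k ≤ n) (ha1 : a 1 = 1) (ha2 : a 2 = 1) (hN : Fintype.card V = n)
    (hbook : ComplBookFree Γ k n) : HasParts Γ 2 a := by
  by_contra hno
  have hempty : ∀ u v, ¬ Γ.Adj u v := by
    intro u v huv
    refine hno ⟨![{u}, {v}], fun i => ?_, fun i j hij x hx y hy => ?_⟩
    · fin_cases i <;> simp [ha1, ha2]
    · fin_cases i <;> fin_cases j <;> simp_all
  obtain ⟨g⟩ : Nonempty (Fin k ↪ V) :=
    Function.Embedding.nonempty_of_card_le (by simpa [hN] using hkn)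
  have := hbook g (fun a b hab => ⟨fun h => hab (g.injective h), hempty _ _⟩) Finset.univ
    fun v _ a => hempty _ _
  rw [Finset.card_univ] at this
  omega

theorem theorem1p3 (k p t : ℕ) (hk : 2 ≤ k) (hp : 2 ≤ p) (ht : 2 ≤ t) :
    ∃ δ : ℝ, ((2 : ℝ) ^ (t ^ (1000 * k ^ 2 * p ^ 2)))⁻¹ ≤ δ ∧
      ∀ n : ℕ, 1 ≤ n → ∀ a : ℕ → ℕ,
        (∀ i, 1 ≤ i → i ≤ p → 1 ≤ a i) →
        (∀ i j, 1 ≤ i → i ≤ j → j < p → a i ≤ a j) →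
        (∀ i, 1 ≤ i → i < p → a i ≤ t) →
        (a p : ℝ) ≤ δ * n →
        a 1 ≤ a p → (2 ≤ a 2 → 2 ≤ a p) →
        (ramseyNumber (completePartite p a) (bookGraph k n) = (p - 1) * (n - 1) + a 1 ↔
            a 1 = 1 ∧ a 2 = 1) ∧
          (a 1 = 1 → a 2 = 1 →
            ramseyNumber (completePartite p a) (bookGraph k n) = (p - 1) * (n - 1) + a 1) ∧
          (2 ≤ a 2 →
            (p - 1) * (n - 1) + a 1 < ramseyNumber (completePartite p a) (bookGraph k n)) := by
  refine ⟨_, le_rfl, fun n hn a hpos hmono hat han h1p h2p => ?_⟩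
  have ha1 : 1 ≤ a 1 := hpos 1 le_rfl (by omega)
  have hap : 1 ≤ a p := hpos p (by omega) le_rfl
  have han' : a p * 2 ^ (t ^ (1000 * k ^ 2 * p ^ 2)) ≤ n := by
    rw [inv_mul_eq_div, le_div_iff₀ (by positivity)] at han
    exact_mod_cast han
  have hlarge : k * t ≤ n := by
    refine le_trans ?_ ((Nat.mul_le_mul_right _ hap).trans han')
    rw [one_mul]
    calc k * t ≤ t ^ k := mul_le_pow_of_two_le ht
      _ ≤ t ^ (1000 * k ^ 2 * p ^ 2) := Nat.pow_le_pow_right (by omega) (by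
        calc k = 1 * k ^ 1 * 1 ^ 2 := by ring
          _ ≤ 1000 * k ^ 2 * p ^ 2 := by gcongr <;> omega)
      _ ≤ _ := Nat.lt_two_pow_self.le
  have hkn : k ≤ n := le_trans (Nat.le_mul_of_pos_right _ (by omega)) hlarge
  have htn : t ≤ n := le_trans (Nat.le_mul_of_pos_left _ (by omega)) hlarge
  have heq : a 1 = 1 → a 2 = 1 →
      ramseyNumber (completePartite p a) (bookGraph k n) = (p - 1) * (n - 1) + a 1 := by
    intro h1 h2
    have hlow := mul_pred_lt_ramseyNumber (k := k) (n := n) (by omega : 1 ≤ p) (by omega) hn hpos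
    have hup : ramseyNumber (completePartite p a) (bookGraph k n) ≤ (p - 1) * (n - 1) + 1 := by
      refine Nat.sInf_le fun Γ => ?_
      by_contra hno
      rw [not_or] at hno
      have hbook := complBookFree_of_not_isContained hkn hno.2
      refine hno.1 (isContained_of_hasParts ?_)
      rcases Nat.lt_or_ge 2 p with hp3 | hp2
      · exact hasParts_of_complBookFree Γ hk hp3 ht h1 h2 hat hap han' (by simp) hbook
      · obtain rfl : p = 2 := by omega
        exact hasParts_two_of_complBookFree Γ hkn h1 h2 (by simp; omega) hbook
    omega
  have hgt : 2 ≤ a 2 →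
      (p - 1) * (n - 1) + a 1 < ramseyNumber (completePartite p a) (bookGraph k n) := by
    intro h2
    refine lt_ramseyNumber_of_two_le hp hk hkn ha1 ((hat 1 le_rfl (by omega)).trans htn)
      (fun i hi hip => ?_) fun i hi hip => ?_
    · rcases hip.lt_or_eq with h | rfl
      · exact hmono 1 i le_rfl hi h
      · exact h1p
    · rcases hip.lt_or_eq with h | rfl
      · exact h2.trans (hmono 2 i (by omega) hi h)
      · exact h2p h2
  refine ⟨⟨fun h => ?_, fun h => heq h.1 h.2⟩, heq, hgt⟩
  have h2 : 1 ≤ a 2 := hpos 2 (by omega) hp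
  have h2' : ¬ 2 ≤ a 2 := fun h' => (hgt h').ne' h
  have h12 : a 1 ≤ a 2 := by
    rcases hp.lt_or_eq with h | rfl
    · exact hmono 1 2 le_rfl (by omega) h
    · exact h1p
  omega
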